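/- Let $G=(V,E,w)$ be a finite graph with $n=|V|\ge 3$ vertices and positive rational edge weights, and let $k\ge 2$. A $k$-cut is a set of edges of $G$ whose deletion leaves at least $k$ connected components, and a minimum $k$-cut is a $k$-cut of least total weight. The Karger–Stein random contraction algorithm works as follows: while the current graph has more than $k$ vertices (and at least one edge), sample an edge with probability proportional to its weight, contract its two end points into one vertex (keeping parallel edges), and remove self-loops; when the loop ends, return the set of edges of the original graph whose end points have been contracted into different remaining vertices. Then there is an absolute constant $C>0$ such that for all such $G$ and $k$ and every fixed minimum $k$-cut $F$ of $G$, the algorithm outputs $F$ with probability at least $$n^{-k}\,(k\ln n)^{-C k^2\ln\ln n}.$$ Moreover, for every fixed $k\ge 2$ there is a constant $C_k>0$ such that for all such $G$ and every minimum $k$-cut $F$ of $G$, this probability is at least $n^{-k}\,2^{-C_k(\ln\ln n)^2}$. -/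

import Mathlib

universe u

/-- A weighted graph `G = (V, E, w)` with positive rational edge weights; the values of `weight`
outside the edge set are never used. -/
structure WeightedGraph (V : Type u) where
  /-- the underlying graph `(V, E)` -/
  graph : SimpleGraph V
  /-- the edge weights `w` -/
  weight : Sym2 V → ℚ
  weight_pos : ∀ e ∈ graph.edgeSet, 0 < weight e

namespace WeightedGraph

/-- The weight of a set of edges. -/
def cutWeight {V : Type u} (G : WeightedGraph V) (F : Finset (Sym2 V)) : ℚ :=
  ∑ e ∈ F, G.weight e

/-- A `k`-cut: a set of edges whose deletion leaves at least `k` connected components. -/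
def IsKCut {V : Type u} (G : WeightedGraph V) (k : ℕ) (F : Finset (Sym2 V)) : Prop :=
  (∀ e ∈ F, e ∈ G.graph.edgeSet) ∧
    k ≤ Nat.card (G.graph.deleteEdges (F : Set (Sym2 V))).ConnectedComponent

/-- A minimum `k`-cut: a `k`-cut of least weight. -/
def IsMinKCut {V : Type u} (G : WeightedGraph V) (k : ℕ) (F : Finset (Sym2 V)) : Prop :=
  G.IsKCut k F ∧ ∀ F' : Finset (Sym2 V), G.IsKCut k F' → G.cutWeight F ≤ G.cutWeight F'

/- A contracted graph is represented by the equivalence relation `r` on the original vertices whose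
classes are its vertices. -/

open Classical in
/-- The edges of the contracted graph, as edges of the original graph: those which have not become
self-loops, i.e. whose end points lie in different classes of `r`. -/
noncomputable def liveEdges {V : Type u} [Fintype V] (G : WeightedGraph V) (r : Setoid V) :
    Finset (Sym2 V) :=
  Finset.univ.filter fun e => e ∈ G.graph.edgeSet ∧ ¬ (e.map (Quotient.mk r)).IsDiag

/-- Contract the two end points of `e`: merge their classes. -/
def contract {V : Type u} (r : Setoid V) (e : Sym2 V) : Setoid V :=
  r ⊔ Relation.EqvGen.setoid fun a b => e = s(a, b)

open Classical in
/-- The weight function from which an edge of the contracted graph is sampled. -/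
noncomputable def liveWeight {V : Type u} [Fintype V] (G : WeightedGraph V) (r : Setoid V)
    (e : Sym2 V) : ENNReal :=
  if e ∈ G.liveEdges r then ENNReal.ofReal (G.weight e : ℝ) else 0

theorem tsum_liveWeight_ne_zero {V : Type u} [Fintype V] (G : WeightedGraph V) (r : Setoid V)
    (h : (G.liveEdges r).Nonempty) : ∑' e, G.liveWeight r e ≠ 0 := by
  obtain ⟨e, he⟩ := h
  intro h0
  have h1 := ENNReal.tsum_eq_zero.1 h0 e
  have h2 : e ∈ G.graph.edgeSet := by
    have := he
    simp only [liveEdges, Finset.mem_filter] at this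
    exact this.2.1
  have h3 : (0 : ℝ) < (G.weight e : ℝ) := by exact_mod_cast G.weight_pos e h2
  simp only [liveWeight, if_pos he, ENNReal.ofReal_eq_zero] at h1
  exact absurd h3 (not_lt.2 h1)

theorem tsum_liveWeight_ne_top {V : Type u} [Fintype V] (G : WeightedGraph V) (r : Setoid V) :
    ∑' e, G.liveWeight r e ≠ ⊤ := by
  classical
  rw [tsum_fintype]
  refine (ENNReal.sum_lt_top.2 fun e _ => ?_).ne
  unfold liveWeight
  split_ifs
  · exact ENNReal.ofReal_lt_top
  · exact ENNReal.zero_lt_top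

/-- Sample an edge of the contracted graph with probability proportional to its weight. -/
noncomputable def sampleEdge {V : Type u} [Fintype V] (G : WeightedGraph V) (r : Setoid V)
    (h : (G.liveEdges r).Nonempty) : PMF (Sym2 V) :=
  PMF.normalize (G.liveWeight r) (G.tsum_liveWeight_ne_zero r h) (G.tsum_liveWeight_ne_top r)

open Classical in
/-- One iteration of the loop: while there are more than `k` vertices, sample an edge and contract
it. If no edge is left (which, with more than `k` vertices, only happens when the original graph has
more than `k` connected components), nothing can be sampled and the loop stops. -/
noncomputable def loopStep {V : Type u} [Fintype V] (G : WeightedGraph V) (k : ℕ)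
    (r : Setoid V) : PMF (Setoid V) :=
  if h : k < Nat.card (Quotient r) ∧ (G.liveEdges r).Nonempty then
    (G.sampleEdge r h.2).map (contract r)
  else
    PMF.pure r

/-- The output distribution of the Karger–Stein algorithm: start with all vertices distinct, run
the loop, and return the edges of `G` between the remaining (expanded) vertices. Every contraction
lowers the number of vertices, so the loop has stopped after `|V|` iterations. -/
noncomputable def kargerStein {V : Type u} [Fintype V] (G : WeightedGraph V) (k : ℕ) :
    PMF (Finset (Sym2 V)) :=
  ((fun p : PMF (Setoid V) => p.bind (G.loopStep k))^[Fintype.card V] (PMF.pure ⊥)).map G.liveEdges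

end WeightedGraph

/-!
Let `μ` be the weight of a minimum `k`-cut `F` divided by `k`. A graph on `R` vertices all of whose
cuts cost at least `2 * μ` has total weight at least `R * μ`, so a random contraction hits `F` with
probability at most `k / R`; if this held at every step, `F` would survive with probability about
`n ^ (-k)`. The cuts of cost less than `2 * μ` spoil the estimate, but there are only `O_k(n)` of
them: a large sunflower of small cuts would cut the graph into `k` parts too cheaply, and cuts with
two large sides are handled by recursion on the two sides. Moreover, the small cuts of cost at least
`μ` that meet `F` in weight at most `ε * μ` are destroyed at a rate that makes up for the deficit in
total weight. Hence the potential, the number of vertices plus `1 / ε` for each such cut that is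
still uncontracted, decreases on average almost as if there were no small cuts, and
`potential ^ (-k / (1 - 2 * ε))` is, up to a constant factor, a lower bound for the success
probability until `O(k / ε)` vertices are left. From then on the bound of Karger and Stein suffices.
Finally one takes `ε = 1 / (4 * log n)`.
-/

theorem rpow_neg_mul_one_add_le {x y κ : ℝ} (hx : 0 < x) (hy : 0 < y) (hκ : 0 ≤ κ) :
    y ^ (-κ) * (1 + κ / y * (y - x)) ≤ x ^ (-κ) := by
  have hscale : x ^ (-κ) = y ^ (-κ) * (x / y) ^ (-κ) := by
    rw [← Real.mul_rpow hy.le (by positivity), mul_div_cancel₀ _ hy.ne']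
  have hbernoulli : 1 + κ * (1 - x / y) ≤ (x / y) ^ (-κ) := by
    rw [Real.rpow_def_of_pos (by positivity)]
    have hlog := Real.log_le_sub_one_of_pos (show 0 < x / y by positivity)
    have hexp := Real.add_one_le_exp (Real.log (x / y) * -κ)
    nlinarith
  rw [hscale]
  refine mul_le_mul_of_nonneg_left (hbernoulli.trans' (le_of_eq ?_)) (Real.rpow_nonneg hy.le _)
  field_simp

theorem sum_sum_filter_eq_sum_card_mul {ι κ : Type*} (A : Finset ι) (B : Finset κ)
    (P : ι → κ → Prop) [∀ i e, Decidable (P i e)] (w : κ → ℝ) :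
    ∑ i ∈ A, ∑ e ∈ B with P i e, w e =
      ∑ e ∈ B, (({i ∈ A | P i e} : Finset ι).card : ℝ) * w e := by
  have := Finset.sum_sum_bipartiteAbove_eq_sum_sum_bipartiteBelow (s := A) (t := B) P fun _ => w
  simpa only [Finset.bipartiteAbove, Finset.bipartiteBelow, Finset.sum_const, nsmul_eq_mul]
    using this

theorem card_le_card_quotient {V ι : Type*} [Finite V] {r : Setoid V} (f : ι → V)
    (hf : ∀ i j, r (f i) (f j) → i = j) : Nat.card ι ≤ Nat.card (Quotient r) :=
  Nat.card_le_card_of_injective (fun i => Quotient.mk r (f i)) fun i j h =>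
    hf i j (Quotient.exact h)

theorem card_quotient_le_of_ker_le {V ι : Type*} [Finite ι] {r : Setoid V} (f : V → ι)
    (hf : Setoid.ker f ≤ r) : Nat.card (Quotient r) ≤ Nat.card ι :=
  Nat.card_le_card_of_injective (fun q : Quotient r => f q.out) fun _ _ h =>
    Quotient.out_equiv_out.1 (hf h)

theorem card_quotient_lt_of_lt {V : Type*} [Finite V] {r s : Setoid V} (h : r < s) :
    Nat.card (Quotient s) < Nat.card (Quotient r) := by
  have hsurj : Function.Surjective (Quotient.map' (s₁ := r) (s₂ := s) id fun _ _ hab => h.le hab) :=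
    fun q => q.inductionOn fun v => ⟨Quotient.mk r v, rfl⟩
  refine (Nat.card_le_card_of_surjective _ hsurj).lt_of_ne fun hcard => h.not_ge fun a b hab => ?_
  have hinj := (Function.Surjective.bijective_of_nat_card_le hsurj hcard.ge).injective
  exact Quotient.exact (hinj (Quotient.sound hab : Quotient.mk s a = Quotient.mk s b))

theorem card_quotient_le_of_le {V : Type*} [Finite V] {r s : Setoid V} (h : r ≤ s) :
    Nat.card (Quotient s) ≤ Nat.card (Quotient r) := by
  rcases h.eq_or_lt with rfl | hlt
  · exact le_rfl
  · exact (card_quotient_lt_of_lt hlt).le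

/-- A sunflower with core `Y`: the sets of `𝒢` properly contain `Y` and any two of them meet
exactly in `Y`. -/
structure IsSunflower {α : Type*} [DecidableEq α] (𝒢 : Finset (Finset α)) (Y : Finset α) :
    Prop where
  core_ssubset : ∀ S ∈ 𝒢, Y ⊂ S
  inter_eq : ∀ S ∈ 𝒢, ∀ T ∈ 𝒢, S ≠ T → S ∩ T = Y

namespace IsSunflower

open Finset

variable {α : Type*} [DecidableEq α] {𝒢 : Finset (Finset α)} {Y S T : Finset α} {a : α}

theorem mono (h : IsSunflower 𝒢 Y) {ℋ : Finset (Finset α)} (hsub : ℋ ⊆ 𝒢) : IsSunflower ℋ Y :=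
  ⟨fun S hS => h.core_ssubset S (hsub hS), fun S hS T hT => h.inter_eq S (hsub hS) T (hsub hT)⟩

theorem eq_of_mem_of_notMem (h : IsSunflower 𝒢 Y) (hS : S ∈ 𝒢) (hT : T ∈ 𝒢) (ha : a ∈ S)
    (ha' : a ∈ T) (haY : a ∉ Y) : S = T := by
  by_contra hne
  exact haY (h.inter_eq S hS T hT hne ▸ mem_inter.2 ⟨ha, ha'⟩)

theorem exists_hitting_set {𝓑 : Finset (Finset α)} {m r : ℕ} (hr : ∀ S ∈ 𝓑, #S ≤ r)
    (hm : ∀ 𝒢 ⊆ 𝓑, IsSunflower 𝒢 Y → #𝒢 ≤ m) :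
    ∃ H : Finset α, #H ≤ m * r ∧ ∀ S ∈ 𝓑, Y ⊂ S → ∃ a ∈ H, a ∈ S ∧ a ∉ Y := by
  classical
  obtain ⟨𝒢, h𝒢, hmax⟩ := exists_maximal (s := {𝒢 ∈ 𝓑.powerset | IsSunflower 𝒢 Y})
    ⟨∅, mem_filter.2 ⟨empty_mem_powerset _, ⟨by simp, by simp⟩⟩⟩
  obtain ⟨hsub, hsun⟩ := mem_filter.1 h𝒢
  rw [mem_powerset] at hsub
  refine ⟨𝒢.biUnion (· \ Y), ?_, fun S hS hYS => ?_⟩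
  · exact (card_biUnion_le_card_mul _ _ _ fun S hS =>
      (card_le_card sdiff_subset).trans (hr S (hsub hS))).trans
      (Nat.mul_le_mul_right _ (hm 𝒢 hsub hsun))
  · by_contra! hmiss
    have hcore : ∀ T ∈ 𝒢, S ∩ T = Y := fun T hT => by
      refine Subset.antisymm (fun a ha => ?_)
        (subset_inter hYS.subset (hsun.core_ssubset T hT).subset)
      by_contra haY
      rw [mem_inter] at ha
      exact haY (hmiss a (mem_biUnion.2 ⟨T, hT, mem_sdiff.2 ⟨ha.2, haY⟩⟩) ha.1)
    have hins : IsSunflower (insert S 𝒢) Y := by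
      refine ⟨forall_mem_insert .. |>.2 ⟨hYS, hsun.core_ssubset⟩, ?_⟩
      simp only [forall_mem_insert]
      exact ⟨⟨fun h => (h rfl).elim, fun T hT _ => hcore T hT⟩, fun T hT =>
        ⟨fun _ => inter_comm T S ▸ hcore T hT, hsun.inter_eq T hT⟩⟩
    have hS𝒢 : S ∈ 𝒢 := hmax (mem_filter.2 ⟨mem_powerset.2 (insert_subset hS hsub), hins⟩)
      (subset_insert S 𝒢) (mem_insert_self S 𝒢)
    exact hYS.ne' ((inter_self S).symm.trans (hcore S hS𝒢))

end IsSunflower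

open Finset in
theorem card_le_pow_of_hitting {α : Type*} {𝓑 : Finset (Finset α)} {Y : Finset α}
    {m j : ℕ} (h𝓑 : ∀ S ∈ 𝓑, Y ⊆ S ∧ #S ≤ #Y + j)
    (hit : ∀ Z, Y ⊆ Z → ∃ H : Finset α, #H ≤ m ∧ ∀ S ∈ 𝓑, Z ⊂ S → ∃ a ∈ H, a ∈ S ∧ a ∉ Z) :
    #𝓑 ≤ (m + 1) ^ j := by
  classical
  induction j generalizing 𝓑 Y with
  | zero =>
    have h : ∀ S ∈ 𝓑, S = Y := fun S hS => (eq_of_subset_of_card_le (h𝓑 S hS).1 (h𝓑 S hS).2).symm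
    exact card_le_one.2 fun S hS T hT => (h S hS).trans (h T hT).symm
  | succ j ih =>
    obtain ⟨H, hH, hhit⟩ := hit Y subset_rfl
    have hcover : 𝓑 ⊆ insert Y ((H \ Y).biUnion fun a => {S ∈ 𝓑 | a ∈ S}) := by
      intro S hS
      rw [mem_insert, mem_biUnion]
      by_cases hSY : S = Y
      · exact Or.inl hSY
      · obtain ⟨a, haH, haS, haY⟩ := hhit S hS ((h𝓑 S hS).1.ssubset_of_ne (Ne.symm hSY))
        exact Or.inr ⟨a, mem_sdiff.2 ⟨haH, haY⟩, mem_filter.2 ⟨hS, haS⟩⟩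
    have hbranch : ∀ a ∈ H \ Y, #{S ∈ 𝓑 | a ∈ S} ≤ (m + 1) ^ j := fun a ha => by
      rw [mem_sdiff] at ha
      refine ih (Y := insert a Y) (fun S hS => ?_) fun Z hZ => ?_
      · rw [mem_filter] at hS
        rw [card_insert_of_notMem ha.2, add_right_comm, add_assoc]
        exact ⟨insert_subset hS.2 (h𝓑 S hS.1).1, (h𝓑 S hS.1).2⟩
      · obtain ⟨H', hH', hhit'⟩ := hit Z ((subset_insert a Y).trans hZ)
        exact ⟨H', hH', fun S hS => hhit' S (mem_filter.1 hS).1⟩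
    calc #𝓑 ≤ #((H \ Y).biUnion fun a => {S ∈ 𝓑 | a ∈ S}) + 1 :=
          (card_le_card hcover).trans (card_insert_le _ _)
      _ ≤ m * (m + 1) ^ j + (m + 1) ^ j := by
          gcongr
          · exact (card_biUnion_le_card_mul _ _ _ hbranch).trans
              (Nat.mul_le_mul_right _ ((card_le_card sdiff_subset).trans hH))
          · exact Nat.one_le_pow _ _ m.succ_pos
      _ = (m + 1) ^ (j + 1) := by ring

open Finset Classical in
theorem card_filter_subset_le_pow {α : Type*} {𝓑 : Finset (Finset α)} {Z : Finset α} {j m : ℕ}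
    (hZ : #Z ≤ m) (hj : ∀ S ∈ 𝓑, #S ≤ j) : #{S ∈ 𝓑 | S ⊆ Z} ≤ (m + 1) ^ j := by
  refine card_le_pow_of_hitting (Y := ∅) (fun S hS => ?_) fun Y _ => ⟨Z, hZ, fun S hS hYS => ?_⟩
  · simpa using hj S (mem_filter.1 hS).1
  · obtain ⟨a, haS, haY⟩ := exists_of_ssubset hYS
    exact ⟨a, (mem_filter.1 hS).2 haS, haS, haY⟩

namespace WeightedGraph

variable {V : Type*} {r s : Setoid V} {a b : V}

theorem le_contract (r : Setoid V) (e : Sym2 V) : r ≤ contract r e :=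
  le_sup_left

theorem contract_le_iff : contract r s(a, b) ≤ s ↔ r ≤ s ∧ s a b := by
  refine sup_le_iff.trans (and_congr_right fun _ => ⟨fun h => h (.rel _ _ rfl), fun hab => ?_⟩)
  refine Setoid.eqvGen_le fun x y hxy => ?_
  rcases Sym2.eq_iff.1 hxy with ⟨rfl, rfl⟩ | ⟨rfl, rfl⟩
  exacts [hab, s.symm hab]

theorem card_quotient_contract_add_one [Finite V] (hab : ¬ r a b) :
    Nat.card (Quotient (contract r s(a, b))) + 1 = Nat.card (Quotient r) := by
  classical
  have hmerge : contract r s(a, b) ≤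
      Setoid.ker fun v => if r v a then Quotient.mk r b else Quotient.mk r v := by
    refine contract_le_iff.2 ⟨fun x y hxy => ?_, ?_⟩
    · have hiff : r x a ↔ r y a := ⟨r.trans (r.symm hxy), r.trans hxy⟩
      simp only [Setoid.ker_def, hiff, Quotient.sound (s := r) hxy]
    · simp only [Setoid.ker_def, r.refl, if_true, ite_self]
  refine le_antisymm (card_quotient_lt_of_lt ((le_contract r _).lt_of_ne fun h => hab ?_)) ?_
  · exact h ▸ (contract_le_iff.1 le_rfl).2
  · rw [← Finite.card_option]
    refine card_quotient_le_of_ker_le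
      (fun v => if r v a then none else some (Quotient.mk (contract r s(a, b)) v))
      fun x y hxy => ?_
    rw [Setoid.ker_def] at hxy
    split_ifs at hxy with hx hy
    · exact r.trans hx (r.symm hy)
    · have hker := hmerge (Quotient.exact (Option.some.inj hxy))
      rw [Setoid.ker_def, if_neg, if_neg] at hker
      exacts [Quotient.exact hker, by assumption, by assumption]

end WeightedGraph

/-- A finite multigraph with vertices `V`, edges `E` and nonnegative real edge weights. Contracting
vertices changes only `ends`, so that contracted graphs keep the edge type `E`; loops are allowed
and never cross a partition. -/
structure WeightedMultigraph (V E : Type*) where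
  /-- The end points of an edge. -/
  ends : E → Sym2 V
  /-- The weight of an edge. -/
  weight : E → ℝ
  weight_nonneg : ∀ e, 0 ≤ weight e

namespace WeightedMultigraph

open Finset

variable {V W E : Type*} [Fintype E] (M : WeightedMultigraph V E)

open Classical in
/-- The edges whose end points lie in different classes of the partition `r`. -/
noncomputable def crossing (r : Setoid V) : Finset E :=
  {e | ¬ ((M.ends e).map (Quotient.mk r)).IsDiag}

/-- The cost of a partition: the total weight of the edges between different classes. -/
noncomputable def cost (r : Setoid V) : ℝ :=
  ∑ e ∈ M.crossing r, M.weight e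

/-- The partition of the vertices into `S` and its complement. -/
def cut (S : Finset V) : Setoid V :=
  Setoid.ker (· ∈ S)

/-- The total weight of the edges leaving `S`. -/
noncomputable def cutCost (S : Finset V) : ℝ :=
  M.cost (cut S)

/-- Every partition into at least `k` classes costs at least `k * μ`; when `k * μ` is the weight of
a minimum `k`-cut, `μ` is the unit in which the paper measures cuts. -/
def KCutBound (k : ℕ) (μ : ℝ) : Prop :=
  ∀ r : Setoid V, k ≤ Nat.card (Quotient r) → k * μ ≤ M.cost r

theorem cut_apply {S : Finset V} {a b : V} : cut S a b ↔ (a ∈ S ↔ b ∈ S) := by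
  rw [cut, Setoid.ker_def, eq_iff_iff]

theorem cut_compl [Fintype V] [DecidableEq V] (S : Finset V) : cut Sᶜ = cut S := by
  ext a b
  simp only [cut_apply, mem_compl, not_iff_not]

variable {M} {r s : Setoid V} {k : ℕ} {μ : ℝ} {e : E} {a b : V}

theorem mem_crossing (he : M.ends e = s(a, b)) : e ∈ M.crossing r ↔ ¬ r a b := by
  simp [crossing, he, Quotient.eq]

theorem mem_crossing_inf : e ∈ M.crossing (r ⊓ s) ↔ e ∈ M.crossing r ∨ e ∈ M.crossing s := by
  induction he : M.ends e with
  | _ a b =>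
    simp only [mem_crossing he, ← not_and_or]
    rfl

theorem crossing_anti (h : r ≤ s) : M.crossing s ⊆ M.crossing r := by
  intro e
  induction he : M.ends e with
  | _ a b => simpa only [mem_crossing he] using mt (h (x := a) (y := b))

theorem mem_crossing_cut {S : Finset V} (he : M.ends e = s(a, b)) :
    e ∈ M.crossing (cut S) ↔ ¬ (a ∈ S ↔ b ∈ S) := by
  rw [mem_crossing he, cut_apply]

theorem exists_ends_of_mem_crossing_cut {S : Finset V} (h : e ∈ M.crossing (cut S)) :
    ∃ a b, M.ends e = s(a, b) ∧ a ∈ S ∧ b ∉ S := by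
  induction he : M.ends e with
  | _ a b =>
    rw [mem_crossing_cut he] at h
    by_cases ha : a ∈ S
    · exact ⟨a, b, rfl, ha, by tauto⟩
    · exact ⟨b, a, Sym2.eq_swap, by tauto, ha⟩

theorem cost_inf_le [DecidableEq E] :
    M.cost (r ⊓ s) ≤ M.cost r + ∑ e ∈ M.crossing s \ M.crossing r, M.weight e := by
  rw [cost, cost, ← sum_union disjoint_sdiff]
  refine sum_le_sum_of_subset_of_nonneg (fun e he => ?_) fun e _ _ => M.weight_nonneg e
  rw [union_sdiff_self_eq_union, mem_union]
  exact mem_crossing_inf.1 he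

theorem KCutBound.exists_saturated [Finite V] [DecidableEq E] (h : M.KCutBound k μ)
    (hr : Nat.card (Quotient r) ≤ k) (hcost : M.cost r < Nat.card (Quotient r) * μ) :
    ∃ s ≤ r, Nat.card (Quotient s) < k ∧
      ∀ S : Finset V, ∑ e ∈ M.crossing (cut S) \ M.crossing r, M.weight e < μ → s ≤ cut S := by
  have : Finite (Setoid V) := Finite.of_injective (fun s a b => s a b) fun s t hst =>
    Setoid.ext fun a b => iff_of_eq (congrFun₂ hst a b)
  obtain ⟨s, ⟨hsr, hsk, hs⟩, hmin⟩ := exists_minimal_of_wellFoundedLT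
    (fun s => s ≤ r ∧ Nat.card (Quotient s) < k ∧ M.cost s < Nat.card (Quotient s) * μ)
    ⟨r, le_rfl, hr.lt_of_ne fun hk => (hk ▸ hcost).not_ge (h r hk.ge), hcost⟩
  refine ⟨s, hsr, hsk, fun S hS => ?_⟩
  by_contra hSs
  have hlt : s ⊓ cut S < s := inf_lt_left.2 hSs
  have hcard : (Nat.card (Quotient s) : ℝ) + 1 ≤ Nat.card (Quotient (s ⊓ cut S)) :=
    mod_cast card_quotient_lt_of_lt hlt
  have hextra : ∑ e ∈ M.crossing (cut S) \ M.crossing s, M.weight e < μ :=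
    (sum_le_sum_of_subset_of_nonneg (sdiff_subset_sdiff subset_rfl (crossing_anti hsr))
      fun e _ _ => M.weight_nonneg e).trans_lt hS
  have hμ : 0 < μ := (sum_nonneg fun e _ => M.weight_nonneg e).trans_lt hextra
  have hsplit : M.cost (s ⊓ cut S) < (Nat.card (Quotient s) + 1) * μ := by
    linarith [cost_inf_le (M := M) (r := s) (s := cut S)]
  refine hlt.not_ge (hmin ⟨hlt.le.trans hsr, ?_, hsplit.trans_le (by gcongr)⟩ hlt.le)
  by_contra! hk
  have hsk' : (Nat.card (Quotient s) : ℝ) + 1 ≤ k := mod_cast hsk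
  exact (hsplit.trans_le (by gcongr)).not_ge (h _ hk)

theorem card_quotient_cut [Finite V] {S : Finset V} (ha : a ∈ S) (hb : b ∉ S) :
    Nat.card (Quotient (cut S)) = 2 := by
  refine le_antisymm ?_ ?_
  · refine (card_quotient_le_of_ker_le (· ∈ S) le_rfl).trans_eq ?_
    rw [Nat.card_eq_fintype_card, Fintype.card_prop]
  · have := card_le_card_quotient (r := cut S) ![a, b] fun i j hij => by
      rw [cut_apply] at hij
      fin_cases i <;> fin_cases j <;> simp_all
    rwa [Nat.card_fin] at this

open Classical in
theorem cost_eq_sum_ite : M.cost r = ∑ e, (if e ∈ M.crossing r then 1 else 0) * M.weight e := by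
  simp only [cost, ite_mul, one_mul, zero_mul, sum_ite_mem, univ_inter]

open Classical in
theorem sum_cutCost (𝒢 : Finset (Finset V)) :
    ∑ S ∈ 𝒢, M.cutCost S = ∑ e, (#{S ∈ 𝒢 | e ∈ M.crossing (cut S)} : ℝ) * M.weight e := by
  rw [← sum_sum_filter_eq_sum_card_mul]
  simp only [cutCost, cost, filter_univ_mem]

theorem sum_cutCost_lt {𝒢 : Finset (Finset V)} (h𝒢 : ∀ S ∈ 𝒢, M.cutCost S < 2 * μ)
    (hne : 𝒢.Nonempty) :
    ∑ S ∈ 𝒢, M.cutCost S < #𝒢 * (2 * μ) := by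
  rw [← nsmul_eq_mul, ← sum_const]
  exact sum_lt_sum_of_nonempty hne h𝒢

/-- The partition of the vertices into the atoms of the set algebra generated by `𝒢`. -/
def atoms (𝒢 : Finset (Finset V)) : Setoid V :=
  Setoid.ker fun v (S : 𝒢) => v ∈ S.1

theorem atoms_apply {𝒢 : Finset (Finset V)} : atoms 𝒢 a b ↔ ∀ S ∈ 𝒢, (a ∈ S ↔ b ∈ S) := by
  rw [atoms, Setoid.ker_def]
  simp only [funext_iff, eq_iff_iff, Subtype.forall]

theorem mem_crossing_atoms {𝒢 : Finset (Finset V)} :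
    e ∈ M.crossing (atoms 𝒢) ↔ ∃ S ∈ 𝒢, e ∈ M.crossing (cut S) := by
  induction he : M.ends e with
  | _ a b => simp only [mem_crossing he, atoms_apply, cut_apply, not_forall, exists_prop]

section Sunflower

variable [DecidableEq V] {𝒢 : Finset (Finset V)} {Y S T : Finset V}

open Classical in
theorem card_le_card_crossing_add_one (h : IsSunflower 𝒢 Y) (he : e ∈ M.crossing (cut Y)) :
    #𝒢 ≤ #{S ∈ 𝒢 | e ∈ M.crossing (cut S)} + 1 := by
  obtain ⟨a, b, hab, ha, hb⟩ := exists_ends_of_mem_crossing_cut he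
  have hmissed : #{S ∈ 𝒢 | e ∉ M.crossing (cut S)} ≤ 1 := card_le_one.2 <| by
    have hmem : ∀ S ∈ 𝒢, e ∉ M.crossing (cut S) → b ∈ S := fun S hS hcross => by
      rw [mem_crossing_cut hab, not_not] at hcross
      exact hcross.1 ((h.core_ssubset S hS).subset ha)
    simp only [mem_filter]
    exact fun S ⟨hS, hSe⟩ T ⟨hT, hTe⟩ =>
      h.eq_of_mem_of_notMem hS hT (hmem S hS hSe) (hmem T hT hTe) hb
  have := card_filter_add_card_filter_not (s := 𝒢) fun S => e ∈ M.crossing (cut S)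
  omega

theorem card_add_two_le_card_quotient [Finite V] (h : IsSunflower 𝒢 Y) (hY : Y.Nonempty)
    {ℋ : Finset (Finset V)} (hℋ : ℋ ⊂ 𝒢) :
    #ℋ + 2 ≤ Nat.card (Quotient (cut Y ⊓ atoms ℋ)) := by
  obtain ⟨y, hy⟩ := hY
  obtain ⟨T, hT, hTℋ⟩ := exists_of_ssubset hℋ
  have hpetal : ∀ S : 𝒢, ∃ x ∈ S.1, x ∉ Y := fun S => exists_of_ssubset (h.core_ssubset S.1 S.2)
  choose x hxS hxY using hpetal
  let rep : Option (Option ℋ) → V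
    | none => y
    | some none => x ⟨T, hT⟩
    | some (some S) => x ⟨S.1, hℋ.subset S.2⟩
  have hcard : Nat.card (Option (Option ℋ)) = #ℋ + 2 := by simp
  rw [← hcard]
  refine card_le_card_quotient rep fun i j ⟨hij, hij'⟩ => ?_
  rw [cut_apply] at hij
  rw [atoms_apply] at hij'
  have hout : ∀ S : ℋ, x ⟨T, hT⟩ ∉ S.1 := fun S hS =>
    hTℋ (h.eq_of_mem_of_notMem hT (hℋ.subset S.2) (hxS _) hS (hxY _) ▸ S.2)
  have hin : ∀ S : ℋ, x ⟨S.1, hℋ.subset S.2⟩ ∈ S.1 := fun S => hxS _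
  rcases i with _ | _ | S <;> rcases j with _ | _ | S'
  all_goals simp only [rep, hy, hxY, iff_false, not_true_eq_false, false_iff] at hij hij' ⊢
  · exact (hout S' ((hij' _ S'.2).2 (hin S'))).elim
  · exact (hout S ((hij' _ S.2).1 (hin S))).elim
  · exact congrArg (some ∘ some) <| Subtype.ext <|
      h.eq_of_mem_of_notMem (hℋ.subset S.2) (hℋ.subset S'.2) (hin S) ((hij' _ S'.2).2 (hin S'))
        (hxY _)

open Classical in
theorem cost_inf_atoms_add_le (h : IsSunflower 𝒢 Y) :
    M.cost (cut Y ⊓ atoms 𝒢) + #𝒢 * M.cutCost Y ≤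
      ∑ S ∈ 𝒢, M.cutCost S + 2 * M.cutCost Y := by
  rw [cutCost, sum_cutCost, cost_eq_sum_ite, cost_eq_sum_ite, mul_sum, mul_sum,
    ← sum_add_distrib, ← sum_add_distrib]
  refine sum_le_sum fun e _ => ?_
  rw [← mul_assoc, ← mul_assoc, ← add_mul, ← add_mul]
  refine mul_le_mul_of_nonneg_right ?_ (M.weight_nonneg e)
  simp only [mem_crossing_inf, mem_crossing_atoms]
  by_cases heY : e ∈ M.crossing (cut Y)
  · have : (#𝒢 : ℝ) ≤ #{S ∈ 𝒢 | e ∈ M.crossing (cut S)} + 1 :=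
      mod_cast card_le_card_crossing_add_one h heY
    simp only [heY, true_or, if_true]
    linarith
  · simp only [heY, false_or, if_false]
    split_ifs with hS
    · obtain ⟨S, hS, heS⟩ := hS
      have : 1 ≤ #{S ∈ 𝒢 | e ∈ M.crossing (cut S)} :=
        card_pos.2 ⟨S, mem_filter.2 ⟨hS, heS⟩⟩
      simpa
    · simp

open Classical in
theorem cost_inf_atoms_add_cost_le (h : IsSunflower 𝒢 Y) (h𝒢 : 3 ≤ #𝒢) (hS : S ∈ 𝒢) (hT : T ∈ 𝒢)
    (hST : S ≠ T) :
    M.cost (cut Y ⊓ atoms {S}) + M.cost (cut Y ⊓ atoms {T}) ≤ ∑ S ∈ 𝒢, M.cutCost S := by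
  rw [sum_cutCost, cost_eq_sum_ite, cost_eq_sum_ite, ← sum_add_distrib]
  refine sum_le_sum fun e _ => ?_
  rw [← add_mul]
  refine mul_le_mul_of_nonneg_right ?_ (M.weight_nonneg e)
  simp only [mem_crossing_inf, mem_crossing_atoms, mem_singleton, exists_eq_left]
  by_cases heY : e ∈ M.crossing (cut Y)
  · have : 2 ≤ #{S ∈ 𝒢 | e ∈ M.crossing (cut S)} := by
      have := card_le_card_crossing_add_one h heY
      omega
    simp only [heY, true_or, if_true]
    exact_mod_cast this
  · have hpair : ({S, T} : Finset (Finset V)) ⊆ 𝒢 := by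
      simp only [insert_subset_iff, singleton_subset_iff, hS, hT, and_self]
    have := card_le_card (filter_subset_filter (fun S => e ∈ M.crossing (cut S)) hpair)
    rw [card_filter, sum_pair hST] at this
    simp only [heY, false_or]
    exact_mod_cast this

theorem KCutBound.card_sunflower_lt_of_four_le [Finite V] (hM : M.KCutBound k μ) (hk : 4 ≤ k)
    (h : IsSunflower 𝒢 Y) (hY : Y.Nonempty) (hYμ : μ ≤ M.cutCost Y)
    (h𝒢 : ∀ S ∈ 𝒢, M.cutCost S < 2 * μ) : #𝒢 < k := by
  by_contra! hcard
  obtain ⟨ℋ, hsub, hcard'⟩ := exists_subset_card_eq (by omega : k - 2 ≤ #𝒢)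
  have hssub : ℋ ⊂ 𝒢 := hsub.ssubset_of_ne <| by rintro rfl; omega
  have hk' : (#ℋ : ℝ) + 2 = k := mod_cast (by omega : #ℋ + 2 = k)
  have hclasses : k * μ ≤ M.cost (cut Y ⊓ atoms ℋ) :=
    hM _ (by have := card_add_two_le_card_quotient h hY hssub; omega)
  have htotal := sum_cutCost_lt (fun S hS => h𝒢 S (hsub hS)) (card_pos.1 (by omega : 0 < #ℋ))
  have hcore : (#ℋ - 2) * μ ≤ (#ℋ - 2) * M.cutCost Y :=
    mul_le_mul_of_nonneg_left hYμ (sub_nonneg.2 (mod_cast (by omega : 2 ≤ #ℋ)))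
  rw [← hk'] at hclasses
  linarith [cost_inf_atoms_add_le (M := M) (h.mono hsub)]

theorem KCutBound.card_sunflower_lt [Finite V] (hM : M.KCutBound k μ) (hk : 2 ≤ k)
    (h : IsSunflower 𝒢 Y) (hY : Y.Nonempty) (hYμ : μ ≤ M.cutCost Y)
    (h𝒢 : ∀ S ∈ 𝒢, M.cutCost S < 2 * μ) : #𝒢 < k := by
  rcases (by omega : k = 2 ∨ k = 3 ∨ 4 ≤ k) with rfl | rfl | hk4
  · by_contra! hcard
    obtain ⟨S, hS, T, hT, hne⟩ := one_lt_card.1 (by omega : 1 < #𝒢)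
    obtain ⟨a, haS, -⟩ := exists_of_ssubset (h.core_ssubset S hS)
    obtain ⟨b, hbT, hbY⟩ := exists_of_ssubset (h.core_ssubset T hT)
    have hbS : b ∉ S := fun hbS => hne (h.eq_of_mem_of_notMem hS hT hbS hbT hbY)
    have hcost : (2 : ℕ) * μ ≤ M.cutCost S := hM _ (card_quotient_cut haS hbS).ge
    exact (h𝒢 S hS).not_ge (mod_cast hcost)
  · by_contra! hcard
    obtain ⟨𝒢', hsub, hcard⟩ := exists_subset_card_eq hcard
    replace h := h.mono hsub
    obtain ⟨S, hS, T, hT, hne⟩ := one_lt_card.1 (by omega : 1 < #𝒢')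
    have hclasses : ∀ S ∈ 𝒢', (3 : ℕ) * μ ≤ M.cost (cut Y ⊓ atoms {S}) := fun S hS =>
      hM _ <| card_add_two_le_card_quotient h hY <| (singleton_subset_iff.2 hS).ssubset_of_ne <| by
        rintro rfl
        simp at hcard
    have htotal := sum_cutCost_lt (fun S hS => h𝒢 S (hsub hS)) ⟨S, hS⟩
    have := cost_inf_atoms_add_cost_le (M := M) h hcard.ge hS hT hne
    have := hclasses S hS
    have := hclasses T hT
    push_cast [hcard] at *
    linarith
  · exact hM.card_sunflower_lt_of_four_le hk4 h hY hYμ h𝒢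

end Sunflower

variable (M) in
/-- The contraction of `M` along `φ`: the vertices of each fibre of `φ` are merged. -/
def map (φ : V → W) : WeightedMultigraph W E where
  ends e := (M.ends e).map φ
  weight := M.weight
  weight_nonneg := M.weight_nonneg

theorem crossing_map (φ : V → W) (σ : Setoid W) :
    (M.map φ).crossing σ = M.crossing (σ.comap φ) := by
  ext e
  induction he : M.ends e with
  | _ a b =>
    have he' : (M.map φ).ends e = s(φ a, φ b) := by simp only [map, he, Sym2.map_mk]
    rw [mem_crossing he, mem_crossing he']
    rfl

theorem cost_map (φ : V → W) (σ : Setoid W) : (M.map φ).cost σ = M.cost (σ.comap φ) := by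
  rw [cost, crossing_map]
  rfl

theorem KCutBound.map [Finite V] (h : M.KCutBound k μ) {φ : V → W} (hφ : φ.Surjective) :
    (M.map φ).KCutBound k μ := by
  refine fun σ hσ => (h (σ.comap φ) (hσ.trans ?_)).trans_eq (cost_map φ σ).symm
  refine card_le_card_quotient (fun q => Function.surjInv hφ (Quotient.out q)) fun q q' hq => ?_
  rw [Setoid.comap_rel, Function.surjInv_eq hφ, Function.surjInv_eq hφ] at hq
  exact Quotient.out_equiv_out.1 hq

theorem comap_cut [Fintype V] [DecidableEq W] (φ : V → W) (T : Finset W) :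
    (cut T).comap φ = cut {v | φ v ∈ T} := by
  ext a b
  simp only [Setoid.comap_rel, cut_apply, mem_filter_univ]

theorem cutCost_map [Fintype V] [DecidableEq W] (φ : V → W) (T : Finset W) :
    (M.map φ).cutCost T = M.cutCost {v | φ v ∈ T} := by
  rw [cutCost, cutCost, cost_map, comap_cut]

/-- The partition obtained from `s` by turning every vertex of `A` into a class of its own. -/
def isolate (A : Finset V) (s : Setoid V) : Setoid V where
  r a b := a = b ∨ a ∉ A ∧ b ∉ A ∧ s a b
  iseqv := by
    refine ⟨fun _ => Or.inl rfl, ?_, ?_⟩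
    · rintro a b (rfl | ⟨ha, hb, hab⟩)
      exacts [Or.inl rfl, Or.inr ⟨hb, ha, s.symm hab⟩]
    · rintro a b c (rfl | ⟨ha, hb, hab⟩) (rfl | ⟨hb', hc, hbc⟩)
      exacts [Or.inl rfl, Or.inr ⟨hb', hc, hbc⟩, Or.inr ⟨ha, hb, hab⟩,
        Or.inr ⟨ha, hc, s.trans hab hbc⟩]

theorem card_quotient_isolate_le [Finite V] (A : Finset V) (s : Setoid V) :
    Nat.card (Quotient (isolate A s)) ≤ #A + Nat.card (Quotient s) := by
  classical
  let f : V → A ⊕ Quotient s := fun v => if h : v ∈ A then .inl ⟨v, h⟩ else .inr (Quotient.mk s v)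
  refine (card_quotient_le_of_ker_le f fun a b hab => ?_).trans_eq ?_
  · rw [Setoid.ker_def] at hab
    by_cases ha : a ∈ A <;> by_cases hb : b ∈ A <;>
      simp only [f, ha, hb, dite_true, dite_false, reduceCtorEq, Sum.inl.injEq, Sum.inr.injEq,
        Subtype.mk.injEq, Quotient.eq] at hab
    exacts [Or.inl hab, Or.inr ⟨ha, hb, hab⟩]
  · rw [Nat.card_sum, Nat.card_eq_fintype_card, Fintype.card_coe]

theorem isolate_le_cut [DecidableEq V] {A S : Finset V} (h : s ≤ cut (S \ A)) :
    isolate A s ≤ cut S := by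
  rintro a b (rfl | ⟨ha, hb, hab⟩)
  · exact (cut S).refl a
  · simpa only [cut_apply, mem_sdiff, ha, hb, not_false_eq_true, and_true] using h hab

section SmallCuts

open Classical in
variable (M) in
/-- The vertex sets whose cut costs less than `2 * μ`. -/
noncomputable def smallCuts [Fintype V] (μ : ℝ) : Finset (Finset V) :=
  {S | M.cutCost S < 2 * μ}

variable [Fintype V] {S T : Finset V}

theorem mem_smallCuts : S ∈ M.smallCuts μ ↔ M.cutCost S < 2 * μ := by
  simp only [smallCuts, mem_filter_univ]

open Classical in
theorem card_filter_le_cut_le [Fintype (Quotient r)] :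
    #{S ∈ M.smallCuts μ | r ≤ cut S} ≤ #((M.map (Quotient.mk r)).smallCuts μ) := by
  refine card_le_card_of_surjOn (fun T => ({v | Quotient.mk r v ∈ T} : Finset V)) fun S hS => ?_
  obtain ⟨hS, hrS⟩ := mem_filter.1 (mem_coe.1 hS)
  have himage : ({v | Quotient.mk r v ∈ S.image (Quotient.mk r)} : Finset V) = S := by
    ext v
    rw [mem_filter_univ, mem_image]
    exact ⟨fun ⟨u, hu, huv⟩ => (cut_apply.1 (hrS (Quotient.exact huv))).1 hu,
      fun hv => ⟨v, hv, rfl⟩⟩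
  refine ⟨S.image (Quotient.mk r), ?_, himage⟩
  rwa [mem_coe, mem_smallCuts, cutCost_map, himage, ← mem_smallCuts]

theorem KCutBound.exists_hitting_set (h : M.KCutBound k μ) (hk : 2 ≤ k) {Y : Finset V} {j : ℕ}
    (hY : Y.Nonempty) (hYμ : #Y < j → μ ≤ M.cutCost Y) :
    ∃ H : Finset V, #H ≤ k * j ∧
      ∀ S ∈ {S ∈ M.smallCuts μ | #S < j}, Y ⊂ S → ∃ a ∈ H, a ∈ S ∧ a ∉ Y := by
  classical
  refine IsSunflower.exists_hitting_set (fun S hS => (mem_filter.1 hS).2.le) fun 𝒢 h𝒢 hsun => ?_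
  rcases 𝒢.eq_empty_or_nonempty with rfl | ⟨S, hS⟩
  · simp
  · have hYj : #Y < j :=
      (card_lt_card (hsun.core_ssubset S hS)).trans (mem_filter.1 (h𝒢 hS)).2
    exact (h.card_sunflower_lt hk hsun hY (hYμ hYj) fun S hS =>
      mem_smallCuts.1 (mem_filter.1 (h𝒢 hS)).1).le

open Classical in
theorem card_smallClass_le (r : Setoid V) (j : ℕ) :
    #{v | #{u | r u v} < j} ≤ Nat.card (Quotient r) * j := by
  have := Fintype.ofFinite (Quotient r)
  rw [Nat.card_eq_fintype_card, mul_comm]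
  refine (card_le_mul_card_image (f := Quotient.mk r) _ j fun q hq => ?_).trans
    (Nat.mul_le_mul_left j (card_le_univ _))
  obtain ⟨v, hv, rfl⟩ := mem_image.1 hq
  refine (card_le_card fun u hu => ?_).trans (mem_filter.1 hv).2.le
  exact mem_filter.2 ⟨mem_univ u, Quotient.exact (mem_filter.1 hu).2⟩

omit [Fintype V] in
theorem KCutBound.exists_le_cut_of_cutCost_lt [Finite V] [Nonempty V] (h : M.KCutBound k μ)
    (hk : 2 ≤ k) (hμ : 0 < μ) : ∃ s : Setoid V, Nat.card (Quotient s) < k ∧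
      ∀ S : Finset V, M.cutCost S < μ → s ≤ cut S := by
  classical
  have hcrossing : M.crossing ⊤ = ∅ := eq_empty_of_forall_notMem fun e => by
    induction he : M.ends e with
    | _ a b => exact fun h => (mem_crossing he).1 h trivial
  have hcard : Nat.card (Quotient (⊤ : Setoid V)) = 1 :=
    Nat.card_eq_one_iff_unique.2
      ⟨⟨fun q q' => Quotient.inductionOn₂ q q' fun _ _ => Quotient.sound trivial⟩,
      ⟨Quotient.mk _ (Classical.arbitrary V)⟩⟩
  obtain ⟨s, -, hsk, hs⟩ := h.exists_saturated (r := ⊤) (by omega) (by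
    rwa [cost, hcrossing, sum_empty, hcard, Nat.cast_one, one_mul])
  exact ⟨s, hsk, fun S hS => hs S (by rwa [hcrossing, sdiff_empty])⟩

open Classical in
theorem KCutBound.card_filter_mem_le (h : M.KCutBound k μ) (hk : 2 ≤ k) {j : ℕ}
    (hμ : ∀ Y : Finset V, a ∈ Y → #Y < j → μ ≤ M.cutCost Y) :
    #{S ∈ M.smallCuts μ | #S < j ∧ a ∈ S} ≤ (k * j + 1) ^ j := by
  refine card_le_pow_of_hitting (Y := {a}) (fun S hS => ?_) fun Y haY => ?_
  · obtain ⟨-, hSj, haS⟩ := mem_filter.1 hS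
    exact ⟨singleton_subset_iff.2 haS, by omega⟩
  · rw [singleton_subset_iff] at haY
    obtain ⟨H, hH, hhit⟩ := h.exists_hitting_set hk ⟨a, haY⟩ (hμ Y haY)
    refine ⟨H, hH, fun S hS => hhit S ?_⟩
    rw [mem_filter] at hS ⊢
    exact ⟨hS.1, hS.2.1⟩

/- A set `Y` of fewer than `j` elements which contains an element outside `Z` is not a union of
classes of the saturated partition, so its cut costs at least `μ` and sunflowers with core `Y`
are small. -/
open Classical in
theorem KCutBound.card_filter_card_lt_le [Nonempty V] (h : M.KCutBound k μ) (hk : 2 ≤ k)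
    (hμ : 0 < μ) (j : ℕ) :
    #{S ∈ M.smallCuts μ | #S < j} ≤ (Fintype.card V + 1) * (k * j + 1) ^ j := by
  obtain ⟨s, hsk, hs⟩ := h.exists_le_cut_of_cutCost_lt hk hμ
  set 𝓑 : Finset (Finset V) := {S ∈ M.smallCuts μ | #S < j}
  set Z : Finset V := {v | #{u | s u v} < j}
  have hinside : #{S ∈ 𝓑 | S ⊆ Z} ≤ (k * j + 1) ^ j :=
    card_filter_subset_le_pow ((card_smallClass_le s j).trans (Nat.mul_le_mul_right j hsk.le))
      fun S hS => (mem_filter.1 hS).2.le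
  have houtside : ∀ v ∉ Z, #{S ∈ 𝓑 | v ∈ S} ≤ (k * j + 1) ^ j := fun v hv => by
    rw [filter_filter]
    refine h.card_filter_mem_le hk fun Y hvY hY => ?_
    by_contra! hYμ
    refine hv (mem_filter.2 ⟨mem_univ v, (card_le_card fun u hu => ?_).trans_lt hY⟩)
    exact (cut_apply.1 (hs Y hYμ (mem_filter.1 hu).2)).2 hvY
  have hcover : 𝓑 ⊆ {S ∈ 𝓑 | S ⊆ Z} ∪ Zᶜ.biUnion fun v => {S ∈ 𝓑 | v ∈ S} := by
    intro S hS
    rw [mem_union, mem_biUnion]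
    by_cases hSZ : S ⊆ Z
    · exact Or.inl (mem_filter.2 ⟨hS, hSZ⟩)
    · obtain ⟨v, hv, hvZ⟩ := not_subset.1 hSZ
      exact Or.inr ⟨v, mem_compl.2 hvZ, mem_filter.2 ⟨hS, hv⟩⟩
  calc #𝓑 ≤ (k * j + 1) ^ j + Fintype.card V * (k * j + 1) ^ j := by
        refine (card_le_card hcover).trans ((card_union_le _ _).trans (add_le_add hinside ?_))
        refine (card_biUnion_le_card_mul _ _ _ fun v hv => houtside v (mem_compl.1 hv)).trans ?_
        gcongr
        exact card_le_univ _
    _ = (Fintype.card V + 1) * (k * j + 1) ^ j := by ring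

theorem sum_crossing_cut_sdiff_add_le [DecidableEq V] [DecidableEq E] (S T : Finset V) :
    ∑ e ∈ M.crossing (cut (S \ T)) \ M.crossing (cut T), M.weight e +
      ∑ e ∈ M.crossing (cut (S \ Tᶜ)) \ M.crossing (cut T), M.weight e ≤ M.cutCost S := by
  rw [← sum_union (disjoint_left.2 fun e => ?_)]
  · refine sum_le_sum_of_subset_of_nonneg (fun e => ?_) fun e _ _ => M.weight_nonneg e
    induction he : M.ends e with
    | _ a b =>
      simp only [mem_union, mem_sdiff, mem_crossing_cut he, mem_compl]
      tauto
  · induction he : M.ends e with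
    | _ a b =>
      simp only [mem_sdiff, mem_crossing_cut he, mem_compl]
      tauto

theorem KCutBound.exists_isolate_le_cut (h : M.KCutBound k μ) (hk : 2 ≤ k) [DecidableEq V]
    (hT : T ∈ M.smallCuts μ) (ha : a ∈ T) (hb : b ∉ T) :
    ∃ s : Setoid V, Nat.card (Quotient s) < k ∧
      ∀ S ∈ M.smallCuts μ, isolate T s ≤ cut S ∨ isolate Tᶜ s ≤ cut S := by
  classical
  have hcard := card_quotient_cut ha hb
  obtain ⟨s, -, hsk, hs⟩ := h.exists_saturated (r := cut T) (by omega) (by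
    rw [hcard]; exact mod_cast mem_smallCuts.1 hT)
  refine ⟨s, hsk, fun S hS => ?_⟩
  by_contra! hcon
  have hT' := not_lt.1 fun hlt => hcon.1 (isolate_le_cut (hs (S \ T) hlt))
  have hTc' := not_lt.1 fun hlt => hcon.2 (isolate_le_cut (hs (S \ Tᶜ) hlt))
  have := mem_smallCuts.1 hS
  have := sum_crossing_cut_sdiff_add_le (M := M) S T
  linarith

open Classical in
theorem KCutBound.card_smallCuts_le_of_unbalanced [Nonempty V] (h : M.KCutBound k μ) (hk : 2 ≤ k)
    (hμ : 0 < μ) {j : ℕ} (hj : ∀ S ∈ M.smallCuts μ, #S < j ∨ #Sᶜ < j) :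
    #(M.smallCuts μ) ≤ 2 * ((Fintype.card V + 1) * (k * j + 1) ^ j) := by
  have hcover : M.smallCuts μ ⊆ {S ∈ M.smallCuts μ | #S < j} ∪
      ({S ∈ M.smallCuts μ | #S < j} : Finset (Finset V)).image compl := fun S hS => by
    rw [mem_union, mem_image]
    refine (hj S hS).imp (fun hSj => mem_filter.2 ⟨hS, hSj⟩) fun hSj =>
      ⟨Sᶜ, mem_filter.2 ⟨?_, hSj⟩, compl_compl S⟩
    rwa [mem_smallCuts, cutCost, cut_compl, ← cutCost, ← mem_smallCuts]
  have hsmall := h.card_filter_card_lt_le hk hμ j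
  rw [two_mul]
  exact (card_le_card hcover).trans ((card_union_le _ _).trans
    (add_le_add hsmall (card_image_le.trans hsmall)))

open Classical in
theorem KCutBound.exists_card_smallCuts_le_add (h : M.KCutBound k μ) (hk : 2 ≤ k)
    (hT : T ∈ M.smallCuts μ) (ha : a ∈ T) (hb : b ∉ T) :
    ∃ r s : Setoid V, Nat.card (Quotient r) ≤ #T + k ∧ Nat.card (Quotient s) ≤ #Tᶜ + k ∧
      #(M.smallCuts μ) ≤ #{S ∈ M.smallCuts μ | r ≤ cut S} + #{S ∈ M.smallCuts μ | s ≤ cut S} := by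
  obtain ⟨s, hsk, hs⟩ := h.exists_isolate_le_cut hk hT ha hb
  refine ⟨isolate T s, isolate Tᶜ s, (card_quotient_isolate_le T s).trans (by omega),
    (card_quotient_isolate_le Tᶜ s).trans (by omega),
    (card_le_card fun S hS => ?_).trans (card_union_le _ _)⟩
  rw [mem_union, mem_filter, mem_filter]
  exact (hs S hS).imp (And.intro hS) (And.intro hS)

end SmallCuts

theorem card_smallCuts_le_of_card_le [Fintype V] (hk : 1 ≤ k) (hV : Fintype.card V ≤ 6 * k) :
    #(M.smallCuts μ) ≤ (k * (3 * k) + 1) ^ (3 * k) :=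
  calc #(M.smallCuts μ) ≤ 2 ^ Fintype.card V := by
        rw [← Fintype.card_finset]
        exact card_le_univ _
    _ ≤ (2 ^ 2) ^ (3 * k) := by
        rw [← pow_mul]
        exact Nat.pow_le_pow_right two_pos (by omega)
    _ ≤ (k * (3 * k) + 1) ^ (3 * k) := Nat.pow_le_pow_left (by nlinarith) _

theorem KCutBound.card_smallCuts_le_mul_sub {V : Type u} [Fintype V] {M : WeightedMultigraph V E}
    (h : M.KCutBound k μ) (hk : 2 ≤ k) (hμ : 0 < μ) :
    #(M.smallCuts μ) ≤
      4 * (k * (3 * k) + 1) ^ (3 * k) * (max (Fintype.card V) (4 * k) - 2 * k) := by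
  classical
  induction hn : Fintype.card V using Nat.strong_induction_on generalizing V with
  | _ n ih =>
  set D := (k * (3 * k) + 1) ^ (3 * k)
  rcases lt_or_ge n (6 * k) with hsmall | hlarge
  · calc #(M.smallCuts μ) ≤ D := card_smallCuts_le_of_card_le (by omega) (hn ▸ hsmall.le)
      _ ≤ D * (4 * (max n (4 * k) - 2 * k)) := Nat.le_mul_of_pos_right _ (by omega)
      _ = 4 * D * (max n (4 * k) - 2 * k) := by ring
  have : Nonempty V := Fintype.card_pos_iff.1 (by omega)
  by_cases hbal : ∀ S ∈ M.smallCuts μ, #S < 3 * k ∨ #Sᶜ < 3 * k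
  · calc #(M.smallCuts μ) ≤ 2 * ((n + 1) * D) :=
          hn ▸ h.card_smallCuts_le_of_unbalanced hk hμ hbal
      _ = D * (2 * (n + 1)) := by ring
      _ ≤ D * (4 * (max n (4 * k) - 2 * k)) := Nat.mul_le_mul_left _ (by omega)
      _ = 4 * D * (max n (4 * k) - 2 * k) := by ring
  push Not at hbal
  obtain ⟨T, hT, hTk, hTk'⟩ := hbal
  have hTn : #T + #Tᶜ = n := by rw [card_add_card_compl, hn]
  obtain ⟨a, ha⟩ := card_pos.1 (by omega : 0 < #T)
  obtain ⟨b, hb⟩ := card_pos.1 (by omega : 0 < #Tᶜ)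
  obtain ⟨r, s, hr, hs, hcard⟩ := h.exists_card_smallCuts_le_add hk hT ha (mem_compl.1 hb)
  have hpart : ∀ (t : Setoid V) (m : ℕ), 3 * k ≤ m → m + 3 * k ≤ n → Nat.card (Quotient t) ≤ m + k →
      #{S ∈ M.smallCuts μ | t ≤ cut S} ≤ 4 * D * (m - k) := fun t m hm hmn ht => by
    have := Fintype.ofFinite (Quotient t)
    rw [Nat.card_eq_fintype_card] at ht
    exact card_filter_le_cut_le.trans ((ih _ (by omega) (h.map Quotient.mk_surjective) rfl).trans
      (Nat.mul_le_mul_left _ (by omega)))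
  calc #(M.smallCuts μ) ≤ 4 * D * (#T - k) + 4 * D * (#Tᶜ - k) :=
        hcard.trans (add_le_add (hpart r #T hTk (by omega) hr) (hpart s #Tᶜ hTk' (by omega) hs))
    _ = 4 * D * (max n (4 * k) - 2 * k) := by rw [← mul_add]; congr 1; omega

theorem KCutBound.card_smallCuts_le [Fintype V] (h : M.KCutBound k μ) (hk : 2 ≤ k) (hμ : 0 < μ)
    (hkV : k ≤ Fintype.card V) :
    #(M.smallCuts μ) ≤ 8 * (k * (3 * k) + 1) ^ (3 * k) * Fintype.card V := by
  refine (h.card_smallCuts_le_mul_sub hk hμ).trans ?_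
  rw [(by norm_num : 8 = 4 * 2), mul_right_comm 4 2, mul_assoc _ 2]
  exact Nat.mul_le_mul_left _ (by omega)

section Degrees

theorem mem_crossing_isolate_top {J : Finset V} :
    e ∈ M.crossing (isolate J ⊤) ↔ ∃ v ∈ J, e ∈ M.crossing (cut {v}) := by
  induction he : M.ends e with
  | _ a b =>
    have hab : isolate J ⊤ a b ↔ a = b ∨ a ∉ J ∧ b ∉ J ∧ True := Iff.rfl
    simp only [mem_crossing he, hab, cut_apply, mem_singleton, and_true, not_or]
    refine ⟨fun ⟨hne, hJ⟩ => ?_, ?_⟩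
    · by_cases ha : a ∈ J
      · exact ⟨a, ha, by simpa using Ne.symm hne⟩
      · exact ⟨b, by tauto, by simpa using hne⟩
    · rintro ⟨v, hv, hne⟩
      exact ⟨fun h => hne (by rw [h]), fun h => hne
        ⟨fun h' => (h.1 (h' ▸ hv)).elim, fun h' => (h.2 (h' ▸ hv)).elim⟩⟩

theorem card_add_one_le_card_quotient_isolate [Finite V] {J : Finset V} (ha : a ∉ J)
    (s : Setoid V) : #J + 1 ≤ Nat.card (Quotient (isolate J s)) := by
  have hcard : Nat.card (Option J) = #J + 1 := by simp
  rw [← hcard]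
  refine card_le_card_quotient (fun v => v.elim a Subtype.val) ?_
  rintro (_ | u) (_ | v) (h | ⟨hu, hv, -⟩)
  · rfl
  · rfl
  · exact (ha ((show a = v.1 from h) ▸ v.2)).elim
  · exact (hv v.2).elim
  · exact (ha ((show u.1 = a from h) ▸ u.2)).elim
  · exact (hu u.2).elim
  · exact congrArg some (Subtype.ext h)
  · exact (hu u.2).elim

theorem cost_isolate_top_le {J : Finset V} :
    M.cost (isolate J ⊤) ≤ ∑ v ∈ J, M.cutCost {v} := by
  classical
  have hcount : ∑ v ∈ J, M.cutCost {v} =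
      ∑ e, (#{v ∈ J | e ∈ M.crossing (cut {v})} : ℝ) * M.weight e := by
    rw [← sum_sum_filter_eq_sum_card_mul]
    simp only [cutCost, cost, filter_univ_mem]
  rw [hcount, cost_eq_sum_ite]
  refine sum_le_sum fun e _ => mul_le_mul_of_nonneg_right ?_ (M.weight_nonneg e)
  split_ifs with he
  · exact mod_cast card_pos.2 (filter_nonempty_iff.2 (mem_crossing_isolate_top.1 he))
  · exact Nat.cast_nonneg _

variable [Fintype V]

theorem KCutBound.le_cost_isolate_top (h : M.KCutBound k μ) {J : Finset V} (hJ : #J + 1 = k)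
    (hV : k ≤ Fintype.card V) : k * μ ≤ M.cost (isolate J ⊤) := by
  obtain ⟨a, -, ha⟩ := exists_mem_notMem_of_card_lt_card (s := J) (t := univ) (by
    rw [card_univ]
    omega)
  exact h _ (hJ.symm.trans_le (card_add_one_le_card_quotient_isolate ha ⊤))

open Classical in
theorem KCutBound.card_filter_cutCost_lt (h : M.KCutBound k μ) (hk : 2 ≤ k) (hμ : 0 ≤ μ)
    (hV : k ≤ Fintype.card V) : #{v | M.cutCost {v} < μ} < k := by
  by_contra! hcon
  obtain ⟨J, hJ, hJk⟩ := exists_subset_card_eq ((Nat.sub_le k 1).trans hcon)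
  have hlt : ∑ v ∈ J, M.cutCost {v} < ∑ _v ∈ J, μ :=
    sum_lt_sum_of_nonempty (card_pos.1 (by omega)) fun v hv => (mem_filter.1 (hJ hv)).2
  rw [sum_const, nsmul_eq_mul] at hlt
  have hJk' : (#J : ℝ) ≤ k := mod_cast (by omega)
  exact absurd (h.le_cost_isolate_top (J := J) (by omega) hV) (not_le.2
    (cost_isolate_top_le.trans_lt (hlt.trans_le (by gcongr))))

open Classical in
theorem card_filter_mem_crossing_isolate_top (he : e ∈ M.crossing ⊥) (m : ℕ) :
    #{J ∈ powersetCard m univ | e ∈ M.crossing (isolate J ⊤)} + (Fintype.card V - 2).choose m =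
      (Fintype.card V).choose m := by
  induction hab : M.ends e with
  | _ a b =>
    have hne : a ≠ b := (mem_crossing hab).1 he
    have havoid : ({J ∈ powersetCard m univ | e ∉ M.crossing (isolate J ⊤)} : Finset (Finset V)) =
        powersetCard m {a, b}ᶜ := by
      ext J
      have hJ : isolate J ⊤ a b ↔ a = b ∨ a ∉ J ∧ b ∉ J ∧ True := Iff.rfl
      simp only [mem_filter, mem_powersetCard, subset_univ, true_and, mem_crossing hab, not_not, hJ,
        hne, false_or, and_true, subset_compl_iff_disjoint_right, disjoint_insert_right,
        disjoint_singleton_right]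
      tauto
    rw [← card_pair hne, ← card_compl, ← card_powersetCard m {a, b}ᶜ, ← havoid,
      card_filter_add_card_filter_not, card_powersetCard, card_univ]

theorem sum_cost_isolate_top (m : ℕ) :
    ∑ J ∈ powersetCard m univ, M.cost (isolate J ⊤) =
      M.cost ⊥ * ((Fintype.card V).choose m - (Fintype.card V - 2).choose m) := by
  classical
  have hfilter : ∀ J : Finset V, M.cost (isolate J ⊤) =
      ∑ e ∈ M.crossing ⊥ with e ∈ M.crossing (isolate J ⊤), M.weight e := fun J => by
    rw [cost, filter_mem_eq_inter, inter_eq_right.2 (crossing_anti bot_le)]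
  simp only [hfilter]
  rw [sum_sum_filter_eq_sum_card_mul, cost, sum_mul]
  refine sum_congr rfl fun e he => ?_
  rw [← card_filter_mem_crossing_isolate_top he m, Nat.cast_add, add_sub_cancel_right, mul_comm]

theorem KCutBound.cost_bot_mul_choose_le (h : M.KCutBound k μ) (hk : 1 ≤ k)
    (hV : k ≤ Fintype.card V) :
    M.cost ⊥ * (Fintype.card V - 2).choose (k - 1) ≤
      (M.cost ⊥ - k * μ) * (Fintype.card V).choose (k - 1) := by
  have havg : ∑ _J ∈ powersetCard (k - 1) (univ : Finset V), k * μ ≤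
      ∑ J ∈ powersetCard (k - 1) univ, M.cost (isolate J ⊤) := sum_le_sum fun J hJ =>
    h.le_cost_isolate_top (by rw [(mem_powersetCard.1 hJ).2, Nat.sub_add_cancel hk]) hV
  rw [sum_const, card_powersetCard, card_univ, nsmul_eq_mul, sum_cost_isolate_top] at havg
  linarith

open Classical in
theorem card_filter_mem_crossing_cut_singleton_le (e : E) :
    #{v | e ∈ M.crossing (cut {v})} ≤ 2 := by
  induction he : M.ends e with
  | _ a b =>
    refine (card_le_card fun v hv => ?_).trans (card_le_two (a := a) (b := b))
    rw [mem_filter_univ, mem_crossing_cut he, mem_singleton, mem_singleton] at hv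
    rw [mem_insert, mem_singleton]
    by_contra! hne
    exact hv ⟨fun h => (hne.1 h.symm).elim, fun h => (hne.2 h.symm).elim⟩

open Classical in
theorem sum_sum_crossing_cut_singleton_le (F : Finset E) :
    ∑ v, ∑ e ∈ F with e ∈ M.crossing (cut {v}), M.weight e ≤ 2 * ∑ e ∈ F, M.weight e := by
  rw [sum_sum_filter_eq_sum_card_mul, mul_sum]
  exact sum_le_sum fun e _ => mul_le_mul_of_nonneg_right
    (mod_cast card_filter_mem_crossing_cut_singleton_le e) (M.weight_nonneg e)

theorem sum_cutCost_singleton_le : ∑ v, M.cutCost {v} ≤ 2 * M.cost ⊥ := by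
  classical
  refine (sum_le_sum fun v _ => ?_).trans (sum_sum_crossing_cut_singleton_le (M.crossing ⊥))
  rw [filter_mem_eq_inter, inter_eq_right.2 (crossing_anti bot_le), cutCost, cost]

end Degrees

section Contraction

open WeightedGraph (contract)

theorem contract_ends_le_iff :
    contract r (M.ends e) ≤ s ↔ r ≤ s ∧ e ∉ M.crossing s := by
  induction he : M.ends e with
  | _ a b => rw [WeightedGraph.contract_le_iff, mem_crossing he, not_not]

theorem card_quotient_contract_ends_add_one [Finite V] (he : e ∈ M.crossing r) :
    Nat.card (Quotient (contract r (M.ends e))) + 1 = Nat.card (Quotient r) := by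
  induction hab : M.ends e with
  | _ a b => exact WeightedGraph.card_quotient_contract_add_one ((mem_crossing hab).1 he)

theorem cost_map_mk_bot : (M.map (Quotient.mk r)).cost ⊥ = M.cost r := by
  rw [cost_map]
  congr 1
  ext a b
  exact Quotient.eq

theorem sum_crossing_sdiff_add [DecidableEq E] {F : Finset E} (hF : F ⊆ M.crossing r)
    (hFw : ∑ e ∈ F, M.weight e = k * μ) :
    ∑ e ∈ M.crossing r \ F, M.weight e + k * μ = M.cost r := by
  rw [← hFw, sum_sdiff hF, cost]

/-- Karger and Stein's lower bound for the probability that the contraction algorithm preserves a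
given minimum `k`-cut, starting with `R` vertices. -/
noncomputable def kargerSteinBound (k R : ℕ) : ℝ :=
  (R.choose (k - 1) * (R - 1).choose (k - 1))⁻¹

theorem KCutBound.kargerSteinBound_mul_cost_le [Finite V] [DecidableEq E] (h : M.KCutBound k μ)
    (hk : 1 ≤ k) (hr : k < Nat.card (Quotient r)) {F : Finset E} (hF : F ⊆ M.crossing r)
    (hFw : ∑ e ∈ F, M.weight e = k * μ) :
    kargerSteinBound k (Nat.card (Quotient r)) * M.cost r ≤
      ∑ e ∈ M.crossing r \ F, M.weight e *
        kargerSteinBound k (Nat.card (Quotient (contract r (M.ends e)))) := by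
  have := Fintype.ofFinite (Quotient r)
  have havg := (h.map (Quotient.mk_surjective (s := r))).cost_bot_mul_choose_le hk
    (Nat.card_eq_fintype_card (α := Quotient r) ▸ hr.le)
  rw [cost_map_mk_bot, ← Nat.card_eq_fintype_card, ← sum_crossing_sdiff_add hF hFw,
    add_sub_cancel_right] at havg
  rw [← sum_crossing_sdiff_add hF hFw]
  have hcontract : ∀ e ∈ M.crossing r \ F, Nat.card (Quotient (contract r (M.ends e))) =
      Nat.card (Quotient r) - 1 := fun e he =>
    Nat.eq_sub_of_add_eq (card_quotient_contract_ends_add_one (mem_sdiff.1 he).1)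
  rw [sum_congr rfl fun e he => congrArg (M.weight e * kargerSteinBound k ·) (hcontract e he),
    ← sum_mul]
  clear hcontract
  generalize Nat.card (Quotient r) = R at *
  have hchoose : ∀ m, k ≤ m + 1 → (0 : ℝ) < m.choose (k - 1) := fun m hm =>
    mod_cast Nat.choose_pos (by omega)
  have h₀ := hchoose R (by omega)
  have h₁ := hchoose (R - 1) (by omega)
  have h₂ := hchoose (R - 2) (by omega)
  rw [kargerSteinBound, kargerSteinBound, Nat.sub_sub, inv_mul_eq_div, ← div_eq_mul_inv,
    div_le_div_iff₀ (by positivity) (by positivity)]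
  nlinarith

end Contraction

section TameCuts

open WeightedGraph (contract)

variable [Fintype V] {F : Finset E} {ε : ℝ} {S : Finset V}

open Classical in
variable (M) in
/-- The cuts of cost between `μ` and `2 * μ` in which the edges of `F` carry at most `ε * μ` of the
weight; here `F` stands for the minimum `k`-cut that the algorithm has to preserve. -/
noncomputable def tameCuts (μ : ℝ) (F : Finset E) (ε : ℝ) : Finset (Finset V) :=
  {S ∈ M.smallCuts μ | μ ≤ M.cutCost S ∧
    ∑ e ∈ F with e ∈ M.crossing (cut S), M.weight e ≤ ε * μ}

theorem mem_tameCuts [DecidableEq E] : S ∈ M.tameCuts μ F ε ↔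
    S ∈ M.smallCuts μ ∧ μ ≤ M.cutCost S ∧
      ∑ e ∈ F with e ∈ M.crossing (cut S), M.weight e ≤ ε * μ := by
  rw [tameCuts, mem_filter]
  congr!

theorem mem_tameCuts_map [Fintype W] [DecidableEq W] {φ : V → W} {T : Finset W} :
    T ∈ (M.map φ).tameCuts μ F ε ↔ ({v | φ v ∈ T} : Finset V) ∈ M.tameCuts μ F ε := by
  classical
  rw [mem_tameCuts, mem_tameCuts, mem_smallCuts, mem_smallCuts, cutCost_map, crossing_map,
    comap_cut]
  rfl

open Classical in
theorem mul_card_filter_heavy_le (F : Finset E) (t : ℝ) :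
    t * #{v | t < ∑ e ∈ F with e ∈ M.crossing (cut {v}), M.weight e} ≤
      2 * ∑ e ∈ F, M.weight e := by
  refine le_trans ?_ (sum_sum_crossing_cut_singleton_le F)
  refine le_trans ?_ (sum_le_sum_of_subset_of_nonneg (filter_subset
    (fun v => t < ∑ e ∈ F with e ∈ M.crossing (cut {v}), M.weight e) _)
    fun _ _ _ => sum_nonneg fun e _ => M.weight_nonneg e)
  rw [mul_comm, ← nsmul_eq_mul]
  exact card_nsmul_le_sum _ _ _ fun v hv => (mem_filter.1 hv).2.le

theorem KCutBound.mul_card_le_cost_bot_add (h : M.KCutBound k μ) (hk : 2 ≤ k) (hμ : 0 < μ)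
    (hV : k ≤ Fintype.card V) (hε : 0 < ε) (hF : ∑ e ∈ F, M.weight e ≤ k * μ) :
    μ * Fintype.card V ≤ M.cost ⊥ + μ * (k + 2 * k / ε + #(M.tameCuts μ F ε)) := by
  classical
  set light : Finset V := {v | M.cutCost {v} < μ}
  set heavy : Finset V := {v | ε * μ < ∑ e ∈ F with e ∈ M.crossing (cut {v}), M.weight e}
  set tame : Finset V := {v | {v} ∈ M.tameCuts μ F ε}
  have hlight : (#light : ℝ) ≤ k := mod_cast (h.card_filter_cutCost_lt hk hμ.le hV).le
  have hheavy : (#heavy : ℝ) ≤ 2 * k / ε := by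
    rw [le_div_iff₀ hε]
    refine le_of_mul_le_mul_right ?_ hμ
    linarith [mul_card_filter_heavy_le (M := M) F (ε * μ)]
  have htame : (#tame : ℝ) ≤ #(M.tameCuts μ F ε) := by
    refine mod_cast card_le_card_of_injOn (fun v => {v}) (fun v hv => ?_)
      singleton_injective.injOn
    exact (mem_filter_univ v).1 hv
  have hrest : ∀ v ∈ (light ∪ heavy ∪ tame)ᶜ, 2 * μ ≤ M.cutCost {v} := by
    intro v hv
    simp only [light, heavy, tame, mem_compl, mem_union, mem_filter_univ, mem_tameCuts,
      mem_smallCuts, not_or, not_and, not_lt] at hv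
    by_contra! hsmall
    exact hv.2 hsmall hv.1.1 hv.1.2
  have hexcept : (#(light ∪ heavy ∪ tame) : ℝ) ≤ k + 2 * k / ε + #(M.tameCuts μ F ε) := by
    have hunion : (#(light ∪ heavy ∪ tame) : ℝ) ≤ #light + #heavy + #tame := mod_cast
      (card_union_le _ _).trans (Nat.add_le_add_right (card_union_le _ _) _)
    linarith
  have hsum : 2 * μ * #(light ∪ heavy ∪ tame)ᶜ ≤ 2 * M.cost ⊥ := by
    refine le_trans ?_ (sum_cutCost_singleton_le (M := M))
    refine le_trans ?_ (sum_le_sum_of_subset_of_nonneg (subset_univ (light ∪ heavy ∪ tame)ᶜ)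
      fun _ _ _ => sum_nonneg fun e _ => M.weight_nonneg e)
    rw [mul_comm, ← nsmul_eq_mul]
    exact card_nsmul_le_sum _ _ _ hrest
  rw [card_compl, Nat.cast_sub (card_le_univ _)] at hsum
  linarith [mul_le_mul_of_nonneg_left hexcept hμ.le]

open Classical in
variable (M) in
/-- The tame cuts none of whose edges has been contracted when the vertices of the contracted graph
are the classes of `r`. -/
noncomputable def survivors (μ : ℝ) (F : Finset E) (ε : ℝ) (r : Setoid V) : Finset (Finset V) :=
  {S ∈ M.tameCuts μ F ε | r ≤ cut S}

open Classical in
theorem mem_survivors : S ∈ M.survivors μ F ε r ↔ S ∈ M.tameCuts μ F ε ∧ r ≤ cut S := by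
  rw [survivors, mem_filter]

theorem card_tameCuts_map_le_card_survivors [Fintype (Quotient r)] :
    #((M.map (Quotient.mk r)).tameCuts μ F ε) ≤ #(M.survivors μ F ε r) := by
  classical
  refine card_le_card_of_injOn (fun T => ({v | Quotient.mk r v ∈ T} : Finset V)) (fun T hT => ?_) ?_
  · refine mem_survivors.2 ⟨mem_tameCuts_map.1 hT, fun a b hab => ?_⟩
    rw [cut_apply, mem_filter_univ, mem_filter_univ, Quotient.sound hab]
  · intro T _ T' _ hTT'
    ext q
    induction q using Quotient.inductionOn with
    | h v => simpa only [mem_filter_univ] using Finset.ext_iff.1 hTT' v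

theorem KCutBound.mul_card_quotient_le_cost_add (h : M.KCutBound k μ) (hk : 2 ≤ k) (hμ : 0 < μ)
    (hr : k ≤ Nat.card (Quotient r)) (hε : 0 < ε) (hF : ∑ e ∈ F, M.weight e ≤ k * μ) :
    μ * Nat.card (Quotient r) ≤ M.cost r + μ * (k + 2 * k / ε + #(M.survivors μ F ε r)) := by
  have := Fintype.ofFinite (Quotient r)
  have hquot := (h.map (Quotient.mk_surjective (s := r))).mul_card_le_cost_bot_add hk hμ
    (Nat.card_eq_fintype_card (α := Quotient r) ▸ hr) hε hF
  rw [cost_map_mk_bot, ← Nat.card_eq_fintype_card] at hquot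
  refine hquot.trans ?_
  gcongr
  exact card_tameCuts_map_le_card_survivors

theorem survivors_contract [DecidableEq E] (e : E) : M.survivors μ F ε (contract r (M.ends e)) =
    {S ∈ M.survivors μ F ε r | e ∉ M.crossing (cut S)} := by
  ext S
  rw [mem_filter, mem_survivors, mem_survivors, contract_ends_le_iff, and_assoc]

theorem card_survivors_sub [DecidableEq E] (e : E) :
    (#(M.survivors μ F ε r) : ℝ) - #(M.survivors μ F ε (contract r (M.ends e))) =
      #{S ∈ M.survivors μ F ε r | e ∈ M.crossing (cut S)} := by
  rw [survivors_contract, sub_eq_iff_eq_add, ← Nat.cast_add, card_filter_add_card_filter_not]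

theorem mul_card_survivors_le [DecidableEq E] : (1 - ε) * μ * #(M.survivors μ F ε r) ≤
    ∑ e ∈ M.crossing r \ F, M.weight e * (#(M.survivors μ F ε r) -
      #(M.survivors μ F ε (contract r (M.ends e)))) := by
  simp only [card_survivors_sub, mul_comm (M.weight _)]
  rw [← sum_sum_filter_eq_sum_card_mul, mul_comm, ← nsmul_eq_mul]
  refine card_nsmul_le_sum _ _ _ fun S hS => ?_
  obtain ⟨hS, hrS⟩ := mem_survivors.1 hS
  obtain ⟨-, hcost, hFS⟩ := mem_tameCuts.1 hS
  have hsplit : M.cutCost S = ∑ e ∈ F with e ∈ M.crossing (cut S), M.weight e +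
      ∑ e ∈ M.crossing r \ F with e ∈ M.crossing (cut S), M.weight e := by
    rw [cutCost, cost, ← sum_filter_add_sum_filter_not (M.crossing (cut S)) (· ∈ F)]
    congr 2 <;> ext e <;> simp only [mem_filter, mem_sdiff]
    · exact and_comm
    · exact ⟨fun he => ⟨⟨crossing_anti hrS he.1, he.2⟩, he.1⟩, fun he => ⟨he.2, he.1.2⟩⟩
  linarith

end TameCuts

section Potential

open WeightedGraph (contract)

variable [Fintype V] {F : Finset E} {ε : ℝ}

variable (M) in
/-- The number of vertices of the contracted graph given by `r`, less the constant
`2 * k + 2 * k / ε` and plus `1 / ε` for each surviving tame cut. A random contraction which spares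
`F` lowers this potential, in expectation, at the rate of a graph without any small cut. -/
noncomputable def potential (k : ℕ) (μ : ℝ) (F : Finset E) (ε : ℝ) (r : Setoid V) : ℝ :=
  Nat.card (Quotient r) - (2 * k + 2 * k / ε) + #(M.survivors μ F ε r) / ε

theorem card_sub_le_potential (hε : 0 < ε) :
    Nat.card (Quotient r) - (2 * k + 2 * k / ε) ≤ M.potential k μ F ε r :=
  le_add_of_nonneg_right (by positivity)

theorem KCutBound.potential_le (h : M.KCutBound k μ) (hk : 2 ≤ k) (hμ : 0 < μ)
    (hkV : k ≤ Fintype.card V) (hε : 0 < ε) (hε' : ε ≤ 1) : M.potential k μ F ε r ≤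
      9 * (k * (3 * k) + 1) ^ (3 * k) / ε * Fintype.card V := by
  have hvert : (Nat.card (Quotient r) : ℝ) ≤ Fintype.card V := by
    rw [← Nat.card_eq_fintype_card]
    exact mod_cast Nat.card_le_card_of_surjective _ Quotient.mk_surjective
  have hsurv : (#(M.survivors μ F ε r) : ℝ) ≤
      8 * (k * (3 * k) + 1) ^ (3 * k) * Fintype.card V := by
    classical
    refine mod_cast (card_le_card fun S hS => ?_).trans (h.card_smallCuts_le hk hμ hkV)
    exact (mem_tameCuts.1 (mem_survivors.1 hS).1).1
  have hone : 1 ≤ ((k * (3 * k) + 1) ^ (3 * k) / ε : ℝ) :=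
    (one_le_div hε).2 (hε'.trans (one_le_pow₀ (le_add_of_nonneg_left (by positivity))))
  calc M.potential k μ F ε r
      ≤ Fintype.card V + 8 * (k * (3 * k) + 1) ^ (3 * k) * Fintype.card V / ε := by
        rw [potential]
        gcongr
        exact (sub_le_self _ (by positivity)).trans hvert
    _ ≤ (k * (3 * k) + 1) ^ (3 * k) / ε * Fintype.card V +
          8 * (k * (3 * k) + 1) ^ (3 * k) * Fintype.card V / ε := by
        gcongr
        exact le_mul_of_one_le_left (by positivity) hone
    _ = _ := by ring

theorem potential_sub_potential_contract (he : e ∈ M.crossing r) :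
    M.potential k μ F ε r - M.potential k μ F ε (contract r (M.ends e)) =
      1 + (#(M.survivors μ F ε r) - #(M.survivors μ F ε (contract r (M.ends e)))) / ε := by
  rw [potential, potential, ← card_quotient_contract_ends_add_one he, Nat.cast_succ]
  ring

theorem KCutBound.mul_potential_le [DecidableEq E] (h : M.KCutBound k μ) (hk : 2 ≤ k) (hμ : 0 < μ)
    (hε : 0 < ε) (hr : 2 * k + 2 * k / ε ≤ (Nat.card (Quotient r) : ℝ)) (hF : F ⊆ M.crossing r)
    (hFw : ∑ e ∈ F, M.weight e = k * μ) :
    μ * ((1 - 2 * ε) * M.potential k μ F ε r) ≤ ∑ e ∈ M.crossing r \ F,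
      M.weight e * (M.potential k μ F ε r - M.potential k μ F ε (contract r (M.ends e))) := by
  have hkr : k ≤ Nat.card (Quotient r) := by
    have : (0 : ℝ) ≤ k + 2 * k / ε := by positivity
    exact_mod_cast (by linarith : (k : ℝ) ≤ Nat.card (Quotient r))
  have hcard := h.mul_card_quotient_le_cost_add hk hμ hkr hε hFw.le
  have hdrift := div_le_div_of_nonneg_right (mul_card_survivors_le (M := M) (r := r) (μ := μ)
    (F := F) (ε := ε)) hε.le
  have hsplit : ∑ e ∈ M.crossing r \ F, M.weight e * (M.potential k μ F ε r -
      M.potential k μ F ε (contract r (M.ends e))) = M.cost r - k * μ +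
        (∑ e ∈ M.crossing r \ F, M.weight e * (#(M.survivors μ F ε r) -
          #(M.survivors μ F ε (contract r (M.ends e))))) / ε := by
    rw [← sum_crossing_sdiff_add hF hFw, add_sub_cancel_right, sum_div, ← sum_add_distrib]
    refine sum_congr rfl fun e he => ?_
    rw [potential_sub_potential_contract (mem_sdiff.1 he).1]
    ring
  rw [hsplit]
  refine le_trans ?_ (add_le_add_right hdrift _)
  have hloss := mul_nonneg (mul_nonneg hμ.le hε.le) (sub_nonneg.2 hr)
  have hleft : μ * ((1 - 2 * ε) * M.potential k μ F ε r) = μ * (1 - 2 * ε) *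
      (Nat.card (Quotient r) - (2 * k + 2 * k / ε)) +
        (μ * #(M.survivors μ F ε r) / ε - 2 * μ * #(M.survivors μ F ε r)) := by
    rw [potential]
    field_simp
  have hright : (1 - ε) * μ * #(M.survivors μ F ε r) / ε =
      μ * #(M.survivors μ F ε r) / ε - μ * #(M.survivors μ F ε r) := by
    field_simp
  rw [hleft, hright]
  linarith

theorem KCutBound.rpow_potential_mul_cost_le [DecidableEq E] (h : M.KCutBound k μ) (hk : 2 ≤ k)
    (hμ : 0 < μ) (hε : 0 < ε) (hε' : ε < 1 / 2)
    (hr : 2 * k + 2 * k / ε + 2 ≤ (Nat.card (Quotient r) : ℝ)) (hF : F ⊆ M.crossing r)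
    (hFw : ∑ e ∈ F, M.weight e = k * μ) :
    max (M.potential k μ F ε r) 1 ^ (-(k / (1 - 2 * ε))) * M.cost r ≤
      ∑ e ∈ M.crossing r \ F, M.weight e *
        max (M.potential k μ F ε (contract r (M.ends e))) 1 ^ (-(k / (1 - 2 * ε))) := by
  have hε₂ : 0 < 1 - 2 * ε := by linarith
  have hstep : ∀ e ∈ M.crossing r \ F, 1 ≤ M.potential k μ F ε (contract r (M.ends e)) := by
    intro e he
    have hcard : (Nat.card (Quotient (contract r (M.ends e))) : ℝ) + 1 = Nat.card (Quotient r) :=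
      mod_cast card_quotient_contract_ends_add_one (mem_sdiff.1 he).1
    linarith [card_sub_le_potential (M := M) (k := k) (μ := μ) (F := F)
      (r := contract r (M.ends e)) hε]
  have hdrift := h.mul_potential_le hk hμ hε (by linarith) hF hFw
  have hΨ : 2 ≤ M.potential k μ F ε r := by
    linarith [card_sub_le_potential (M := M) (k := k) (μ := μ) (F := F) (r := r) hε]
  rw [max_eq_left (by linarith), ← sum_crossing_sdiff_add hF hFw]
  set Ψ := M.potential k μ F ε
  set κ := k / (1 - 2 * ε)
  calc Ψ r ^ (-κ) * (∑ e ∈ M.crossing r \ F, M.weight e + k * μ)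
      = Ψ r ^ (-κ) * (∑ e ∈ M.crossing r \ F, M.weight e +
          κ / Ψ r * (μ * ((1 - 2 * ε) * Ψ r))) := by
        simp only [κ]
        field_simp
    _ ≤ Ψ r ^ (-κ) * (∑ e ∈ M.crossing r \ F, M.weight e +
          κ / Ψ r * ∑ e ∈ M.crossing r \ F,
            M.weight e * (Ψ r - Ψ (contract r (M.ends e)))) := by
        gcongr
    _ = ∑ e ∈ M.crossing r \ F,
          M.weight e * (Ψ r ^ (-κ) * (1 + κ / Ψ r * (Ψ r - Ψ (contract r (M.ends e))))) := by
        rw [mul_sum, ← sum_add_distrib, mul_sum]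
        exact sum_congr rfl fun e _ => by ring
    _ ≤ _ := by
        refine sum_le_sum fun e he => mul_le_mul_of_nonneg_left ?_ (M.weight_nonneg e)
        rw [max_eq_left (hstep e he)]
        exact rpow_neg_mul_one_add_le (one_pos.trans_le (hstep e he)) (by linarith) (by positivity)

end Potential

end WeightedMultigraph

theorem iterate_bind_eq_bind_iterate {α : Type*} (step : α → PMF α) (j : ℕ) (p : PMF α) :
    (fun q : PMF α => q.bind step)^[j] p =
      p.bind fun a => (fun q : PMF α => q.bind step)^[j] (PMF.pure a) := by
  induction j with
  | zero => exact (PMF.bind_pure p).symm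
  | succ j ih => simp only [Function.iterate_succ_apply', ih, PMF.bind_bind]

namespace WeightedGraph

open Finset

variable {V : Type*} {G : WeightedGraph V} {k : ℕ} {F : Finset (Sym2 V)} {r s : Setoid V}
  {e : Sym2 V}

open Classical in
variable (G) in
/-- The weighted graph as a multigraph whose edges are all the unordered pairs of vertices; the
pairs which are not edges of the graph have weight zero. -/
noncomputable def toMultigraph : WeightedMultigraph V (Sym2 V) where
  ends := id
  weight e := if e ∈ G.graph.edgeSet then G.weight e else 0
  weight_nonneg e := by
    split_ifs with he
    exacts [mod_cast (G.weight_pos e he).le, le_rfl]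

theorem weight_toMultigraph (he : e ∈ G.graph.edgeSet) : G.toMultigraph.weight e = G.weight e :=
  if_pos he

theorem weight_toMultigraph_of_notMem (he : e ∉ G.graph.edgeSet) : G.toMultigraph.weight e = 0 :=
  if_neg he

theorem sum_weight_toMultigraph (hF : ∀ e ∈ F, e ∈ G.graph.edgeSet) :
    ∑ e ∈ F, G.toMultigraph.weight e = G.cutWeight F := by
  rw [cutWeight, Rat.cast_sum]
  exact sum_congr rfl fun e he => weight_toMultigraph (hF e he)

variable (G F) in
/-- The partition into the connected components which remain after deleting `F`. -/
def cutSetoid : Setoid V :=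
  (G.graph.deleteEdges (F : Set (Sym2 V))).reachableSetoid

theorem contract_le_cutSetoid (hr : r ≤ G.cutSetoid F) (he : e ∈ G.graph.edgeSet) (heF : e ∉ F) :
    contract r e ≤ G.cutSetoid F := by
  induction e with
  | _ a b =>
    refine contract_le_iff.2 ⟨hr, SimpleGraph.Adj.reachable ?_⟩
    exact SimpleGraph.deleteEdges_adj.2 ⟨he, heF⟩

theorem IsMinKCut.eq_of_subset (hF : G.IsMinKCut k F) {F' : Finset (Sym2 V)} (hF' : G.IsKCut k F')
    (hsub : F' ⊆ F) : F' = F := by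
  by_contra hne
  obtain ⟨e, he, he'⟩ := exists_of_ssubset (hsub.ssubset_of_ne hne)
  refine (hF.2 F' hF').not_gt (sum_lt_sum_of_subset hsub he he' ?_ fun e he _ => ?_)
  exacts [G.weight_pos e (hF.1.1 e he), (G.weight_pos e (hF.1.1 e he)).le]

section Fintype

variable [Fintype V]

theorem mem_liveEdges :
    e ∈ G.liveEdges r ↔ e ∈ G.graph.edgeSet ∧ e ∈ G.toMultigraph.crossing r := by
  classical
  rw [liveEdges, WeightedMultigraph.crossing, mem_filter, mem_filter]
  simp only [mem_univ, true_and]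
  rfl

theorem sum_toReal_liveWeight_mul (f : Sym2 V → ℝ) :
    ∑ e, (G.liveWeight r e).toReal * f e =
      ∑ e ∈ G.toMultigraph.crossing r, G.toMultigraph.weight e * f e := by
  classical
  rw [← sum_filter_add_sum_filter_not univ (· ∈ G.toMultigraph.crossing r), filter_mem_eq_inter,
    univ_inter, sum_eq_zero (s := univ.filter _), add_zero]
  · refine sum_congr rfl fun e he => ?_
    rw [liveWeight]
    by_cases hG : e ∈ G.graph.edgeSet
    · rw [if_pos (mem_liveEdges.2 ⟨hG, he⟩), weight_toMultigraph hG,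
        ENNReal.toReal_ofReal (mod_cast (G.weight_pos e hG).le)]
    · rw [if_neg fun h => hG (mem_liveEdges.1 h).1, weight_toMultigraph_of_notMem hG,
        ENNReal.toReal_zero]
  · intro e he
    rw [liveWeight, if_neg fun h => (mem_filter.1 he).2 (mem_liveEdges.1 h).2, ENNReal.toReal_zero,
      zero_mul]

theorem cost_toMultigraph : G.toMultigraph.cost r = G.cutWeight (G.liveEdges r) := by
  classical
  rw [← sum_weight_toMultigraph fun e he => (mem_liveEdges.1 he).1, WeightedMultigraph.cost]
  exact (sum_subset (fun e he => (mem_liveEdges.1 he).2) fun e he hlive =>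
    weight_toMultigraph_of_notMem fun hG => hlive (mem_liveEdges.2 ⟨hG, he⟩)).symm

theorem cutSetoid_le_iff : G.cutSetoid F ≤ s ↔ G.liveEdges s ⊆ F := by
  constructor
  · intro h e he
    obtain ⟨hG, hs⟩ := mem_liveEdges.1 he
    by_contra hF
    have hcontract := (contract_le_cutSetoid le_rfl hG hF).trans h
    exact (WeightedMultigraph.contract_ends_le_iff.1 hcontract).2 hs
  · intro h a b hab
    induction (SimpleGraph.reachable_iff_reflTransGen a b).1 hab with
    | refl => exact s.refl a
    | tail hreach hadj ih =>
      obtain ⟨hG, hF⟩ := SimpleGraph.deleteEdges_adj.1 hadj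
      refine s.trans (ih ((SimpleGraph.reachable_iff_reflTransGen _ _).2 hreach)) ?_
      by_contra hs
      exact hF (h (mem_liveEdges.2 ⟨hG, (WeightedMultigraph.mem_crossing rfl).2 hs⟩))

theorem isKCut_liveEdges (h : k ≤ Nat.card (Quotient s)) : G.IsKCut k (G.liveEdges s) :=
  ⟨fun _ he => (mem_liveEdges.1 he).1,
    h.trans (card_quotient_le_of_le (cutSetoid_le_iff.2 Subset.rfl))⟩

namespace IsMinKCut

theorem kCutBound (hF : G.IsMinKCut k F) {μ : ℝ} (hμ : k * μ = G.cutWeight F) :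
    G.toMultigraph.KCutBound k μ := by
  intro r hr
  rw [hμ, cost_toMultigraph]
  exact_mod_cast hF.2 _ (isKCut_liveEdges hr)

theorem liveEdges_cutSetoid (hF : G.IsMinKCut k F) : G.liveEdges (G.cutSetoid F) = F :=
  hF.eq_of_subset (isKCut_liveEdges hF.1.2) (cutSetoid_le_iff.1 le_rfl)

theorem subset_crossing (hF : G.IsMinKCut k F) (hr : r ≤ G.cutSetoid F) :
    F ⊆ G.toMultigraph.crossing r := by
  intro e he
  rw [← hF.liveEdges_cutSetoid] at he
  exact WeightedMultigraph.crossing_anti hr (mem_liveEdges.1 he).2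

end IsMinKCut

theorem liveEdges_nonempty_of_lt_cutSetoid (hr : r < G.cutSetoid F) : (G.liveEdges r).Nonempty := by
  by_contra hempty
  rw [not_nonempty_iff_eq_empty] at hempty
  exact hr.not_ge (cutSetoid_le_iff.2 (hempty ▸ empty_subset F))

end Fintype

theorem IsMinKCut.card_quotient_cutSetoid [Finite V] (hF : G.IsMinKCut k F) (hne : F.Nonempty) :
    Nat.card (Quotient (G.cutSetoid F)) = k := by
  have := Fintype.ofFinite V
  refine le_antisymm ?_ hF.1.2
  by_contra! hlt
  obtain ⟨e, he⟩ := hne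
  have hcross := hF.subset_crossing le_rfl he
  have hcard := WeightedMultigraph.card_quotient_contract_ends_add_one hcross
  have hcut : G.IsKCut k (G.liveEdges (contract (G.cutSetoid F) e)) :=
    isKCut_liveEdges (Nat.le_of_lt_succ (hlt.trans_eq hcard.symm))
  have hlive := hF.eq_of_subset hcut (cutSetoid_le_iff.1 (le_contract _ e))
  rw [← hlive] at he
  exact (WeightedMultigraph.contract_ends_le_iff.1 le_rfl).2 (mem_liveEdges.1 he).2

section SuccessProb

variable [Fintype V]

variable (G k F r) in
/-- The probability that the contraction algorithm returns `F` when it is started with the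
contracted graph given by `r`. The number of classes of `r` bounds the number of iterations. -/
noncomputable def successProb : ℝ :=
  (((fun p : PMF (Setoid V) => p.bind (G.loopStep k))^[Nat.card (Quotient r)] (PMF.pure r)).map
    G.liveEdges F).toReal

theorem successProb_bot : G.successProb k F ⊥ = (G.kargerStein k F).toReal := by
  rw [successProb, Nat.card_congr (Setoid.quotientBotEquiv), Nat.card_eq_fintype_card, kargerStein]

theorem successProb_liveEdges (h : ¬ (k < Nat.card (Quotient r) ∧ (G.liveEdges r).Nonempty)) :
    G.successProb k (G.liveEdges r) r = 1 := by
  have hfixed : (PMF.pure r).bind (G.loopStep k) = PMF.pure r := by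
    rw [PMF.pure_bind, loopStep, dif_neg h]
  rw [successProb, Function.iterate_fixed hfixed, PMF.pure_map, PMF.pure_apply, if_pos rfl,
    ENNReal.toReal_one]

theorem toReal_sampleEdge (h : (G.liveEdges r).Nonempty) :
    (G.sampleEdge r h e).toReal = (G.liveWeight r e).toReal / G.toMultigraph.cost r := by
  have hcost := sum_toReal_liveWeight_mul (G := G) (r := r) fun _ => 1
  simp only [mul_one] at hcost
  have htop := G.tsum_liveWeight_ne_top r
  rw [tsum_fintype, ENNReal.sum_ne_top] at htop
  rw [sampleEdge, PMF.normalize_apply, ENNReal.toReal_mul, ENNReal.toReal_inv, tsum_fintype,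
    ENNReal.toReal_sum htop, hcost, WeightedMultigraph.cost, div_eq_mul_inv]

theorem cost_pos (h : (G.liveEdges r).Nonempty) : 0 < G.toMultigraph.cost r := by
  rw [cost_toMultigraph]
  exact_mod_cast sum_pos (fun e he => G.weight_pos e (mem_liveEdges.1 he).1) h

theorem cost_mul_successProb (hr : k < Nat.card (Quotient r)) (h : (G.liveEdges r).Nonempty) :
    G.toMultigraph.cost r * G.successProb k F r = ∑ e ∈ G.toMultigraph.crossing r,
      G.toMultigraph.weight e * G.successProb k F (contract r e) := by
  classical
  set next : ℕ → Setoid V → PMF (Finset (Sym2 V)) := fun j s =>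
    ((fun p : PMF (Setoid V) => p.bind (G.loopStep k))^[j] (PMF.pure s)).map G.liveEdges
  obtain ⟨R, hR⟩ := Nat.exists_eq_succ_of_ne_zero hr.ne_bot
  have hstep : G.successProb k F r =
      ∑ e, (G.sampleEdge r h e).toReal * (next R (contract r e) F).toReal := by
    rw [successProb, hR, Function.iterate_succ_apply, PMF.pure_bind, loopStep, dif_pos ⟨hr, h⟩,
      iterate_bind_eq_bind_iterate, PMF.bind_map, PMF.map_bind, PMF.bind_apply, tsum_fintype,
      ENNReal.toReal_sum fun e _ =>
        ENNReal.mul_ne_top (PMF.apply_ne_top _ _) (PMF.apply_ne_top _ _)]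
    exact sum_congr rfl fun e _ => ENNReal.toReal_mul
  have hcost := (cost_pos h).ne'
  simp only [hstep, toReal_sampleEdge, mul_sum, ← mul_assoc, mul_div_cancel₀ _ hcost]
  rw [sum_toReal_liveWeight_mul]
  refine sum_congr rfl fun e he => ?_
  have hcard : Nat.card (Quotient (contract r e)) = R := Nat.succ_injective
    ((WeightedMultigraph.card_quotient_contract_ends_add_one he).trans hR)
  rw [successProb, hcard]

theorem IsMinKCut.le_successProb [DecidableEq V] (hF : G.IsMinKCut k F) (Φ : Setoid V → ℝ)
    (hΦ₁ : Φ (G.cutSetoid F) ≤ 1)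
    (hΦ : ∀ r < G.cutSetoid F, Φ r ≤ G.successProb k F r ∨
      Φ r * G.toMultigraph.cost r ≤ ∑ e ∈ G.toMultigraph.crossing r \ F,
        G.toMultigraph.weight e * Φ (contract r e))
    (hr : r ≤ G.cutSetoid F) : Φ r ≤ G.successProb k F r := by
  induction hR : Nat.card (Quotient r) using Nat.strong_induction_on generalizing r with
  | _ R ih =>
    rcases hr.eq_or_lt with rfl | hlt
    · refine hΦ₁.trans_eq ?_
      have hhalt := successProb_liveEdges (G := G) (k := k) (r := G.cutSetoid F) fun h => by
        rw [hF.liveEdges_cutSetoid] at h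
        exact h.1.ne' (hF.card_quotient_cutSetoid h.2)
      rwa [hF.liveEdges_cutSetoid, eq_comm] at hhalt
    refine (hΦ r hlt).elim id fun hdrift => ?_
    have hlive := liveEdges_nonempty_of_lt_cutSetoid hlt
    refine le_of_mul_le_mul_right ?_ (cost_pos hlive)
    rw [mul_comm (G.successProb k F r),
      cost_mul_successProb (hF.1.2.trans_lt (card_quotient_lt_of_lt hlt)) hlive]
    refine hdrift.trans ((sum_le_sum fun e he => ?_).trans
      (sum_le_sum_of_subset_of_nonneg sdiff_subset fun e _ _ =>
        mul_nonneg (G.toMultigraph.weight_nonneg e) ENNReal.toReal_nonneg))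
    obtain ⟨hcross, heF⟩ := mem_sdiff.1 he
    by_cases hG : e ∈ G.graph.edgeSet
    · have hcard := WeightedMultigraph.card_quotient_contract_ends_add_one hcross
      refine mul_le_mul_of_nonneg_left (ih _ ?_ (contract_le_cutSetoid hr hG heF) rfl)
        (G.toMultigraph.weight_nonneg e)
      rw [← hR, ← hcard]
      exact Nat.lt_succ_self _
    · simp only [weight_toMultigraph_of_notMem hG, zero_mul, le_refl]

end SuccessProb

section LowerBounds

open WeightedMultigraph (kargerSteinBound)

theorem kargerSteinBound_le_one (k R : ℕ) : kargerSteinBound k R ≤ 1 := by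
  rw [kargerSteinBound, ← Nat.cast_mul]
  exact Nat.cast_inv_le_one _

theorem inv_pow_le_kargerSteinBound {R : ℕ} (hk : 1 ≤ k) (hR : k ≤ R) :
    ((R : ℝ) ^ (2 * k))⁻¹ ≤ kargerSteinBound k R := by
  have hchoose : ∀ m ≤ R, m.choose (k - 1) ≤ R ^ k := fun m hm =>
    (Nat.choose_le_pow m (k - 1)).trans
      ((Nat.pow_le_pow_left hm _).trans (Nat.pow_le_pow_right (hk.trans hR) (Nat.sub_le k 1)))
  rw [kargerSteinBound, ← Nat.cast_mul, two_mul, pow_add, ← Nat.cast_pow, ← Nat.cast_mul]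
  refine inv_anti₀ (Nat.cast_pos.2 (Nat.mul_pos ?_ ?_)) (Nat.cast_le.2
    (Nat.mul_le_mul (hchoose R le_rfl) (hchoose (R - 1) (Nat.sub_le R 1)))) <;>
  exact Nat.choose_pos (by omega)

namespace IsMinKCut

variable {μ ε : ℝ}

theorem sum_weight (hF : G.IsMinKCut k F) (hμ : k * μ = G.cutWeight F) :
    ∑ e ∈ F, G.toMultigraph.weight e = k * μ := by
  rw [sum_weight_toMultigraph hF.1.1, hμ]

variable [Fintype V]

theorem kargerSteinBound_le_successProb (hF : G.IsMinKCut k F) (hk : 1 ≤ k)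
    (hr : r ≤ G.cutSetoid F) :
    kargerSteinBound k (Nat.card (Quotient r)) ≤ G.successProb k F r := by
  classical
  have hμ : k * ((G.cutWeight F : ℝ) / k) = G.cutWeight F :=
    mul_div_cancel₀ _ (Nat.cast_ne_zero.2 (by omega))
  exact hF.le_successProb (fun r => kargerSteinBound k (Nat.card (Quotient r)))
    (kargerSteinBound_le_one _ _) (fun r hr => Or.inr <|
      (hF.kCutBound hμ).kargerSteinBound_mul_cost_le hk
        (hF.1.2.trans_lt (card_quotient_lt_of_lt hr)) (hF.subset_crossing hr.le)
        (hF.sum_weight hμ)) hr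

theorem mul_rpow_potential_le_successProb (hF : G.IsMinKCut k F) (hk : 2 ≤ k) (hμ₀ : 0 < μ)
    (hμ : k * μ = G.cutWeight F) (hε : 0 < ε) (hε' : ε < 1 / 2) (hr : r ≤ G.cutSetoid F) :
    ((2 * k + 2 * k / ε + 2) ^ (2 * k))⁻¹ *
      max (G.toMultigraph.potential k μ F ε r) 1 ^ (-(k / (1 - 2 * ε))) ≤
        G.successProb k F r := by
  classical
  have hε₂ : 0 < 1 - 2 * ε := by linarith
  have hbase : (1 : ℝ) ≤ 2 * k + 2 * k / ε + 2 := by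
    have : (0 : ℝ) ≤ 2 * k + 2 * k / ε := by positivity
    linarith
  have hΨ : ∀ r, max (G.toMultigraph.potential k μ F ε r) 1 ^ (-(k / (1 - 2 * ε))) ≤ 1 := fun r =>
    Real.rpow_le_one_of_one_le_of_nonpos (le_max_right _ _) (neg_nonpos.2 (by positivity))
  refine hF.le_successProb (fun r => ((2 * k + 2 * k / ε + 2) ^ (2 * k))⁻¹ *
    max (G.toMultigraph.potential k μ F ε r) 1 ^ (-(k / (1 - 2 * ε)))) ?_ (fun r hr => ?_) hr
  · exact mul_le_one₀ (inv_le_one_of_one_le₀ (one_le_pow₀ hbase)) (by positivity) (hΨ _)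
  rcases le_total (Nat.card (Quotient r) : ℝ) (2 * k + 2 * k / ε + 2) with hsmall | hlarge
  · left
    have hkr : k ≤ Nat.card (Quotient r) := hF.1.2.trans (card_quotient_le_of_le hr.le)
    have hr₀ : (0 : ℝ) < Nat.card (Quotient r) := mod_cast (by omega : 0 < k).trans_le hkr
    calc _ ≤ ((2 * k + 2 * k / ε + 2) ^ (2 * k))⁻¹ :=
          mul_le_of_le_one_right (by positivity) (hΨ r)
      _ ≤ ((Nat.card (Quotient r) : ℝ) ^ (2 * k))⁻¹ := by gcongr
      _ ≤ kargerSteinBound k (Nat.card (Quotient r)) :=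
          inv_pow_le_kargerSteinBound (by omega) hkr
      _ ≤ G.successProb k F r := hF.kargerSteinBound_le_successProb (by omega) hr.le
  · right
    have hdrift := (hF.kCutBound hμ).rpow_potential_mul_cost_le hk hμ₀ hε hε' hlarge
      (hF.subset_crossing hr.le) (hF.sum_weight hμ)
    simp only [mul_assoc, mul_left_comm (G.toMultigraph.weight _)]
    rw [← mul_sum]
    gcongr
    exact hdrift

theorem one_le_kargerStein_empty (h : G.IsMinKCut k ∅) : 1 ≤ (G.kargerStein k ∅).toReal := by
  classical
  rw [← successProb_bot]
  refine h.le_successProb (fun _ => 1) le_rfl (fun r _ => Or.inr ?_) bot_le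
  simp only [one_mul, mul_one, sdiff_empty, WeightedMultigraph.cost, le_refl]

theorem mul_rpow_le_kargerStein (hF : G.IsMinKCut k F) (hk : 2 ≤ k) (hε : 0 < ε)
    (hε' : ε < 1 / 2) :
    ((2 * k + 2 * k / ε + 2) ^ (2 * k))⁻¹ * (9 * (k * (3 * k) + 1) ^ (3 * k) / ε *
      Fintype.card V) ^ (-(k / (1 - 2 * ε))) ≤ (G.kargerStein k F).toReal := by
  have hε₂ : 0 < 1 - 2 * ε := by linarith
  have hkV : k ≤ Fintype.card V := by
    rw [← Nat.card_eq_fintype_card]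
    exact hF.1.2.trans
      (Nat.card_le_card_of_surjective (Quotient.mk (G.cutSetoid F)) Quotient.mk_surjective)
  have hkV₁ : (1 : ℝ) ≤ Fintype.card V := mod_cast (by omega : 1 ≤ k).trans hkV
  have hD : (1 : ℝ) ≤ 9 * (k * (3 * k) + 1) ^ (3 * k) / ε * Fintype.card V := by
    refine one_le_mul_of_one_le_of_one_le ((one_le_div hε).2 ?_) hkV₁
    have : (1 : ℝ) ≤ (k * (3 * k) + 1) ^ (3 * k) :=
      one_le_pow₀ (le_add_of_nonneg_left (by positivity))
    linarith
  rcases F.eq_empty_or_nonempty with rfl | hne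
  · refine le_trans (mul_le_one₀ ?_ (by positivity) ?_) hF.one_le_kargerStein_empty
    · refine inv_le_one_of_one_le₀ (one_le_pow₀ ?_)
      have : (0 : ℝ) ≤ 2 * k + 2 * k / ε := by positivity
      linarith
    · exact Real.rpow_le_one_of_one_le_of_nonpos hD (neg_nonpos.2 (by positivity))
  have hk₀ : (0 : ℝ) < k := by positivity
  have hcut : (0 : ℝ) < G.cutWeight F :=
    mod_cast sum_pos (fun e he => G.weight_pos e (hF.1.1 e he)) hne
  have hμ : k * ((G.cutWeight F : ℝ) / k) = G.cutWeight F := mul_div_cancel₀ _ hk₀.ne'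
  rw [← successProb_bot]
  refine le_trans ?_
    (hF.mul_rpow_potential_le_successProb hk (div_pos hcut hk₀) hμ hε hε' bot_le)
  refine mul_le_mul_of_nonneg_left ?_ (by positivity)
  refine Real.rpow_le_rpow_of_nonpos (by positivity) (max_le ?_ hD) (neg_nonpos.2 (by positivity))
  exact (hF.kCutBound hμ).potential_le hk (div_pos hcut hk₀) hkV hε (by linarith)

end IsMinKCut

end LowerBounds

end WeightedGraph

section Numerics

open Real

variable {k : ℕ} {l n : ℝ}

theorem one_lt_log_three : 1 < log 3 := by
  rw [lt_log_iff_exp_lt (by norm_num)]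
  exact exp_one_lt_d9.trans (by norm_num)

theorem two_mul_add_le_pow (hk : 2 ≤ k) (hl : 1 ≤ l) :
    2 * k + 2 * k / (1 / (4 * l)) + 2 ≤ (k * l) ^ 5 := by
  have hk' : (2 : ℝ) ≤ k := mod_cast hk
  have hkl : (k : ℝ) ≤ k * l := le_mul_of_one_le_right (by positivity) hl
  have hdiv : 2 * k / (1 / (4 * l)) = 8 * (k * l) := by
    field_simp
    norm_num
  calc 2 * k + 2 * k / (1 / (4 * l)) + 2 ≤ 2 ^ 4 * (k * l) := by
        rw [hdiv]
        linarith
    _ ≤ (k * l) ^ 4 * (k * l) := by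
        gcongr
        exact hk'.trans hkl
    _ = (k * l) ^ 5 := (pow_succ _ _).symm

theorem nine_mul_pow_div_le_pow (hk : 2 ≤ k) (hl : 1 ≤ l) :
    9 * (k * (3 * k) + 1) ^ (3 * k) / (1 / (4 * l)) ≤ (k * l) ^ (15 * k) := by
  have hk' : (2 : ℝ) ≤ k := mod_cast hk
  have hkl : (k : ℝ) ≤ k * l := le_mul_of_one_le_right (by positivity) hl
  have hbase : (k * (3 * k) + 1 : ℝ) ≤ (k * l) ^ 4 :=
    calc (k * (3 * k) + 1 : ℝ) ≤ 2 ^ 2 * k ^ 2 := by nlinarith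
      _ ≤ (k * l) ^ 2 * (k * l) ^ 2 := by
          gcongr
          exact hk'.trans hkl
      _ = (k * l) ^ 4 := by ring
  have hlin : 36 * l ≤ (k * l) ^ 6 :=
    calc 36 * l ≤ 2 ^ 5 * (k * l) := by nlinarith
      _ ≤ (k * l) ^ 5 * (k * l) := by
          gcongr
          exact hk'.trans hkl
      _ = (k * l) ^ 6 := (pow_succ _ _).symm
  calc 9 * (k * (3 * k) + 1) ^ (3 * k) / (1 / (4 * l))
      = (k * (3 * k) + 1) ^ (3 * k) * (36 * l) := by
        field_simp
        norm_num
    _ ≤ ((k * l) ^ 4) ^ (3 * k) * (k * l) ^ 6 := by gcongr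
    _ = (k * l) ^ (12 * k + 6) := by ring
    _ ≤ (k * l) ^ (15 * k) := pow_le_pow_right₀ (by linarith) (by omega)

theorem rpow_div_one_sub_le (hn : 3 ≤ n) (hk : 2 ≤ k) :
    n ^ (k / (1 - 2 * (1 / (4 * log n)))) ≤ n ^ k * (k * log n) ^ (2 * k) := by
  have hl : 1 < log n := one_lt_log_three.trans_le (log_le_log (by norm_num) hn)
  have hk' : (2 : ℝ) ≤ k := mod_cast hk
  have hkl : 2 ≤ k * log n := by nlinarith
  have hexp : log n * (k / (1 - 2 * (1 / (4 * log n)))) ≤ log n * k + k := by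
    rw [show 1 - 2 * (1 / (4 * log n)) = (2 * log n - 1) / (2 * log n) by field_simp; ring,
      div_div_eq_mul_div, ← mul_div_assoc, div_le_iff₀ (by linarith)]
    nlinarith
  calc n ^ (k / (1 - 2 * (1 / (4 * log n))))
      ≤ exp (log n * k + k) := by
        rw [rpow_def_of_pos (by linarith)]
        exact exp_le_exp.2 hexp
    _ = n ^ k * exp 1 ^ k := by
        rw [exp_add, ← rpow_def_of_pos (by linarith), rpow_natCast, ← exp_nat_mul, mul_one]
    _ ≤ n ^ k * ((k * log n) ^ 2) ^ k := by
        gcongr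
        nlinarith [exp_one_lt_d9, hkl]
    _ = n ^ k * (k * log n) ^ (2 * k) := by rw [pow_mul]

theorem pow_mul_rpow_le (hn : 3 ≤ n) (hk : 2 ≤ k) :
    (2 * k + 2 * k / (1 / (4 * log n)) + 2) ^ (2 * k) *
      (9 * (k * (3 * k) + 1) ^ (3 * k) / (1 / (4 * log n)) * n) ^
        (k / (1 - 2 * (1 / (4 * log n)))) ≤ n ^ k * (k * log n) ^ (36 * k ^ 2) := by
  have hl : 1 < log n := one_lt_log_three.trans_le (log_le_log (by norm_num) hn)
  have hk' : (2 : ℝ) ≤ k := mod_cast hk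
  have hkl : 1 ≤ k * log n := by nlinarith
  have hhalf : 1 / 2 ≤ 1 - 2 * (1 / (4 * log n)) := by
    rw [show 2 * (1 / (4 * log n)) = 1 / (2 * log n) by field_simp; norm_num]
    linarith [one_div_le_one_div_of_le two_pos (by linarith : 2 ≤ 2 * log n)]
  have : 0 ≤ k / (1 - 2 * (1 / (4 * log n))) := div_nonneg (by positivity) (by linarith)
  have hκ : k / (1 - 2 * (1 / (4 * log n))) ≤ (2 * k : ℕ) := by
    rw [div_le_iff₀ (by linarith)]
    push_cast
    nlinarith
  calc _ ≤ ((k * log n) ^ 5) ^ (2 * k) *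
        (((k * log n) ^ (15 * k)) ^ (k / (1 - 2 * (1 / (4 * log n)))) *
          n ^ (k / (1 - 2 * (1 / (4 * log n))))) := by
        rw [mul_rpow (by positivity) (by positivity)]
        gcongr
        · exact two_mul_add_le_pow hk hl.le
        · exact nine_mul_pow_div_le_pow hk hl.le
    _ ≤ ((k * log n) ^ 5) ^ (2 * k) *
        (((k * log n) ^ (15 * k)) ^ (2 * k) * (n ^ k * (k * log n) ^ (2 * k))) := by
        gcongr
        · rw [← rpow_natCast _ (2 * k)]
          exact rpow_le_rpow_of_exponent_le (one_le_pow₀ hkl) hκ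
        · exact rpow_div_one_sub_le hn hk
    _ = n ^ k * (k * log n) ^ (30 * k ^ 2 + 12 * k) := by ring
    _ ≤ n ^ k * (k * log n) ^ (36 * k ^ 2) := by
        gcongr
        nlinarith

theorem rpow_neg_log_le_inv_pow (hk : 2 ≤ k) (hl : log 3 ≤ l) :
    (k * l) ^ (-(36 / log (log 3) * k ^ 2 * log l)) ≤ ((k * l) ^ (36 * k ^ 2))⁻¹ := by
  have hl₁ : 1 < log 3 := one_lt_log_three
  have hk' : (2 : ℝ) ≤ k := mod_cast hk
  have hL : 1 ≤ log l / log (log 3) :=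
    (one_le_div (log_pos hl₁)).2 (log_le_log (by linarith) hl)
  have hkl : 1 ≤ k * l := by nlinarith
  have hexp : ((36 * k ^ 2 : ℕ) : ℝ) ≤ 36 / log (log 3) * k ^ 2 * log l := by
    push_cast
    calc 36 * (k : ℝ) ^ 2 ≤ 36 * k ^ 2 * (log l / log (log 3)) :=
          le_mul_of_one_le_right (by positivity) hL
      _ = 36 / log (log 3) * k ^ 2 * log l := by ring
  rw [rpow_neg (by linarith), ← rpow_natCast _ (36 * k ^ 2)]
  exact inv_anti₀ (rpow_pos_of_pos (by linarith) _) (rpow_le_rpow_of_exponent_le hkl hexp)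

theorem two_rpow_neg_log_sq_le_inv_pow (hk : 2 ≤ k) (hl : log 3 ≤ l) :
    (2 : ℝ) ^ (-(36 * k ^ 2 * (log k / log (log 3) + 1) / (log (log 3) * log 2) * log l ^ 2)) ≤
      ((k * l) ^ (36 * k ^ 2))⁻¹ := by
  have hl₁ : 1 < log 3 := one_lt_log_three
  have hk' : (2 : ℝ) ≤ k := mod_cast hk
  have hL₀ : 0 < log (log 3) := log_pos hl₁
  have hL : log (log 3) ≤ log l := log_le_log (by linarith) hl
  have hlogl : 0 ≤ log l := hL₀.le.trans hL
  have : 0 < log 2 := log_pos one_lt_two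
  have : 0 ≤ log k := log_nonneg (by linarith)
  have hlog : log (k * l) ≤ (log k / log (log 3) + 1) / log (log 3) * log l ^ 2 :=
    calc log (k * l) = log k / log (log 3) * log (log 3) + log l := by
          rw [log_mul (by positivity) (by linarith), div_mul_cancel₀ _ hL₀.ne']
      _ ≤ log k / log (log 3) * log l + log l := by gcongr
      _ = (log k / log (log 3) + 1) / log (log 3) * (log l * log (log 3)) := by
          field_simp
      _ ≤ (log k / log (log 3) + 1) / log (log 3) * log l ^ 2 := by
          rw [sq]
          gcongr
  rw [rpow_neg two_pos.le, rpow_def_of_pos two_pos]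
  refine inv_anti₀ (pow_pos (mul_pos (by linarith) (by linarith)) _) ?_
  rw [← exp_log (mul_pos (by linarith) (by linarith) : 0 < k * l), ← exp_nat_mul, exp_le_exp]
  push_cast
  calc 36 * (k : ℝ) ^ 2 * log (k * l)
      ≤ 36 * k ^ 2 * ((log k / log (log 3) + 1) / log (log 3) * log l ^ 2) := by gcongr
    _ = _ := by field_simp

end Numerics

namespace WeightedGraph

theorem IsMinKCut.inv_mul_inv_le_kargerStein {V : Type*} [Fintype V] {G : WeightedGraph V} {k : ℕ}
    {F : Finset (Sym2 V)} (hk : 2 ≤ k) (hV : 3 ≤ Fintype.card V) (hF : G.IsMinKCut k F) :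
    ((Fintype.card V : ℝ) ^ k)⁻¹ * ((k * Real.log (Fintype.card V)) ^ (36 * k ^ 2))⁻¹ ≤
      (G.kargerStein k F).toReal := by
  have hn : (3 : ℝ) ≤ Fintype.card V := mod_cast hV
  have hl : 1 < Real.log (Fintype.card V) :=
    one_lt_log_three.trans_le (Real.log_le_log (by norm_num) hn)
  have hε : 1 / (4 * Real.log (Fintype.card V)) < 1 / 2 :=
    one_div_lt_one_div_of_lt two_pos (by linarith)
  refine le_trans ?_ (hF.mul_rpow_le_kargerStein hk (by positivity) hε)
  rw [Real.rpow_neg (by positivity), ← mul_inv, ← mul_inv]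
  exact inv_anti₀ (by positivity) (pow_mul_rpow_le hn hk)

end WeightedGraph

theorem theorem1 :
    (∃ C : ℝ, 0 < C ∧
      ∀ (V : Type u) [Fintype V] (G : WeightedGraph V) (k : ℕ) (F : Finset (Sym2 V)),
        2 ≤ k → 3 ≤ Fintype.card V → G.IsMinKCut k F →
          ((Fintype.card V : ℝ) ^ k)⁻¹ *
              ((k : ℝ) * Real.log (Fintype.card V)) ^
                (-(C * (k : ℝ) ^ 2 * Real.log (Real.log (Fintype.card V)))) ≤
            (G.kargerStein k F).toReal) ∧
    (∀ k : ℕ, 2 ≤ k → ∃ C : ℝ, 0 < C ∧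
      ∀ (V : Type u) [Fintype V] (G : WeightedGraph V) (F : Finset (Sym2 V)),
        3 ≤ Fintype.card V → G.IsMinKCut k F →
          ((Fintype.card V : ℝ) ^ k)⁻¹ *
              (2 : ℝ) ^ (-(C * Real.log (Real.log (Fintype.card V)) ^ 2)) ≤
            (G.kargerStein k F).toReal) := by
  have hL : 0 < Real.log (Real.log 3) := Real.log_pos one_lt_log_three
  have hl {n : ℕ} (hn : 3 ≤ n) : Real.log 3 ≤ Real.log n :=
    Real.log_le_log (by norm_num) (mod_cast hn)
  refine ⟨⟨36 / Real.log (Real.log 3), by positivity, fun V _ G k F hk hV hF => ?_⟩,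
    fun k hk => ⟨36 * k ^ 2 * (Real.log k / Real.log (Real.log 3) + 1) /
      (Real.log (Real.log 3) * Real.log 2), by positivity, fun V _ G F hV hF => ?_⟩⟩
  · refine le_trans ?_ (hF.inv_mul_inv_le_kargerStein hk hV)
    gcongr
    exact rpow_neg_log_le_inv_pow hk (hl hV)
  · refine le_trans ?_ (hF.inv_mul_inv_le_kargerStein hk hV)
    gcongr
    exact two_rpow_neg_log_sq_le_inv_pow hk (hl hV)
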